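/- **Setting.** Let $\Phi$ be a nondegenerate conic in $\mathbb{CP}^2$, with polarity $\rho$. For a line $p$ not tangent to $\Phi$ and $Q\in p$ write $Q_p=p\cdot\rho(Q)$ (the conjugate point). For collinear points, $(XYZW)=\frac{XZ}{YZ}:\frac{XW}{YW}$ is the cross ratio. For different points $X,Y\notin\Phi$ whose line $p=XY$ is not tangent to $\Phi$, let $P=\rho(p)$ and let $\{X_1,X_2\}=PX\cap\Phi$, $\{Y_1,Y_2\}=PY\cap\Phi$; the two *midpoints* of $\overline{XY}$ are $X_1Y_1\cdot X_2Y_2$ and $X_1Y_2\cdot X_2Y_1$. If $XY$ is tangent to $\Phi$ at $R$, the midpoints are $R$ and the harmonic conjugate of $R$ with respect to $X,Y$. The *complementary midpoints* of $\overline{XY}$ are the midpoints of the segment $\overline{XY_p}$ (so $X\ne Y_p$). A segment is *oriented* by choosing a preferred midpoint $D$ and a preferred complementary midpoint $G$, and then $$\mathbf{cc}(XY)=(X\,Y\,Y_p\,D),\qquad \mathbf{ss}(XY)=(X\,Y_p\,Y\,G).$$ Let $\mathscr T$ be a triangle with vertices $A,B,C$ and sides $a=BC$, $b=CA$, $c=AB$,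 and let $\mathscr T'$ be its polar triangle, with sides $a'=\rho(A)$, $b'=\rho(B)$, $c'=\rho(C)$ and vertices $A'=\rho(a)$, $B'=\rho(b)$, $C'=\rho(c)$. Assume general position: the vertices and sides of $\mathscr T$ and $\mathscr T'$ are all different and no vertex of either lies on $\Phi$. $\mathscr T$ is *right-angled* if two of its sides are conjugate. Put $A_0=a\cdot a'$, $B_0=b\cdot b'$, $C_0=c\cdot c'$, $A_b=b\cdot a'$, $A_c=c\cdot a'$, $B_a=a\cdot b'$, $B_c=c\cdot b'$, $C_a=a\cdot c'$, $C_b=b\cdot c'$. The *magic midpoints* are the midpoints of $\overline{B_cC_b}$, $\overline{C_aA_c}$, $\overline{A_bB_a}$. Suppose that $\overline{BC},\overline{CA},\overline{AB}$ are oriented, with preferred midpoints $D,E,F$ and preferred complementary midpoints $G,H,I$, and that $\overline{B'C'},\overline{C'A'},\overline{A'B'}$ are oriented, with $D',E',F'$ and $G',H',I'$. $\mathscr T$ is *coherently oriented* if $D,E,F$ are noncollinear and different from $A_0,B_0,C_0$ respectively, the same holds for $D',E',F'$, and there are noncollinear magic midpoints $\tilde D,\tilde E,\tilde F$ on $B_cC_b$,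 $C_aA_c$, $A_bB_a$ respectively such that $\tilde D\in DD',HI,H'I'$; $\tilde E\in EE',IG,I'G'$; $\tilde F\in FF',GH,G'H'$. **Theorem (projective law of cosines).** (1) If $\mathscr T$ is not right-angled and is coherently oriented, then $$\mathbf{cc}(BC)=-\mathbf{ss}(AB)\,\mathbf{ss}(CA)\,\mathbf{cc}(B'C')-\mathbf{cc}(AB)\,\mathbf{cc}(CA),$$ $$\mathbf{cc}(B'C')=-\mathbf{ss}(A'B')\,\mathbf{ss}(C'A')\,\mathbf{cc}(BC)-\mathbf{cc}(A'B')\,\mathbf{cc}(C'A'),$$ and the formulae obtained by cyclically permuting $A,B,C$ hold as well. (2) Let moreover $\Phi$ have an equation with real coefficients and let $\mathscr T$ be real and in general position (no orientation, and no absence of right angles, is assumed here). To a side $\overline{XY}$ of $\mathscr T$ or $\mathscr T'$, on the line $p$ with $p\cap\Phi=\{U,V\}$, attach a magnitude $m$ and real numbers $\mathcal C,\mathcal S$ as follows. A real point off $\Phi$ is called interior if its polar contains no real point of $\Phi$, and exterior otherwise. If $p$ contains no real point of $\Phi$, then $m=\frac1{2i}\log(UVXY)\in(0,\pi)$, an elliptic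 distance or an angle between lines, determined up to $m\leftrightarrow\pi-m$, and $\mathcal C=\cos m$, $\mathcal S=\sin m$. Otherwise let $m\ge 0$ be the hyperbolic distance $\frac12|\log(UVX^*Y^*)|$, where $X^*$ is the interior one of $X,X_p$ and $Y^*$ the interior one of $Y,Y_p$; then $(\mathcal C,\mathcal S)=(\cosh m,\sinh m)$ if $X,Y$ are both interior or both exterior, and $(\mathcal C,\mathcal S)=(\sinh m,\cosh m)$ if exactly one of them is interior. Denote by $a,b,c,\alpha,\beta,\gamma$ the magnitudes of $\overline{BC},\overline{CA},\overline{AB},\overline{B'C'},\overline{C'A'},\overline{A'B'}$. With suitable determinations of those among them that are angles or elliptic distances, the following holds. * For every orientation of the sides, $\mathbf{cc}=\pm u\,\mathcal C$ and $\mathbf{ss}=\pm v\,\mathcal S$ on each side, where $(u,v)=(1,1)$ if $p$ contains no real point of $\Phi$, $(u,v)=(1,i)$ if $p$ is secant and $X,Y$ are both interior or both exterior, and $(u,v)=(i,1)$ if $p$ is secant and exactly one of $X,Y$ is interior. * If $\Phi$ has no real points (elliptic triangles), then $\cos a=\cos b\cos c+\sin b\sin c\cos\alpha$ and $\cos\alpha=-\cos\beta\cos\gamma+\sin\beta\sin\gamma\cos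 a$, together with their cyclic permutations. * If $\Phi$ has real points (hyperbolic generalized triangles), there is a sign for each of the six magnitudes, the same in all six laws, such that, with $x_s$ the product of the sign and of $\mathcal C(s)$, $$\varepsilon_A\,x_a=-x_b\,x_c+\mathcal S(b)\,\mathcal S(c)\,x_\alpha,\qquad \varepsilon_{A'}\,x_\alpha=-x_\beta\,x_\gamma+\mathcal S(\beta)\,\mathcal S(\gamma)\,x_a,$$ together with their cyclic permutations, where $\varepsilon_P=-1$ for interior and $\varepsilon_P=1$ for exterior points $P$; the sign of a side of $\mathscr T$ or $\mathscr T'$ with two interior endpoints is $+$. For instance, if $A,B,C$ are interior, then, for suitable determinations of the angles, $\cosh a=\cosh b\cosh c-\sinh b\sinh c\cos\alpha$ and $\cos\alpha=-\cos\beta\cos\gamma+\sin\beta\sin\gamma\cosh a$. -/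

import Mathlib

open scoped LinearAlgebra.Projectivization

noncomputable section

namespace ProjTrig

/-! ### The complex projective plane, its lines, and cross ratios -/

/-- Homogeneous coordinates of the complex projective plane. -/
abbrev Vec : Type := Fin 3 → ℂ

/-- Points of the complex projective plane. -/
abbrev Point : Type := ℙ ℂ Vec

/-- Lines are represented by the corresponding (two-dimensional) subspaces of `ℂ³`. -/
abbrev Line : Type := Submodule ℂ Vec

/-- Incidence of a point with a line. -/
def On (P : Point) (p : Line) : Prop := P.submodule ≤ p

/-- The line `AB` joining two different points. -/
def join (A B : Point) : Line := A.submodule ⊔ B.submodule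

/-- The intersection point `p · q` of two different lines
(an arbitrary point if `p`, `q` do not meet in exactly one point). -/
def meet (p q : Line) : Point := Classical.epsilon fun P : Point => P.submodule = p ⊓ q

/-- `bracket O X Y` is `Y - X` in homogeneous form, for points of a line that does not contain
`O`: if `X = e + s f` and `Y = e + t f`, then it is `(t - s) · det (e, f, O)`. -/
def bracket (O X Y : Vec) : ℂ := Matrix.det (Matrix.of ![X, Y, O])

/-- The cross ratio `(ABCD) = (AC / BC) : (AD / BD)` of four points of a line, `A ≠ B`.
The auxiliary vector `O` is the complex conjugate of the cross product of `A` and `B`, which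
never lies on the line `AB`; any other vector off the line gives the same value. -/
def crossRatio (A B C D : Point) : ℂ :=
  let O : Vec := star (crossProduct A.rep B.rep)
  (bracket O A.rep C.rep * bracket O B.rep D.rep) /
    (bracket O B.rep C.rep * bracket O A.rep D.rep)

/-! ### Nondegenerate conics, polarity, conjugacy -/

/-- A nondegenerate conic `{ P : Pᵀ M P = 0 }` of the complex projective plane. -/
structure Conic where
  M : Matrix (Fin 3) (Fin 3) ℂ
  symm : M.IsSymm
  nondeg : M.det ≠ 0

/-- The point `P` lies on the conic. -/
def Conic.Contains (Φ : Conic) (P : Point) : Prop :=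
  P.rep ⬝ᵥ (Φ.M.mulVec P.rep) = 0

/-- The polar line `ρ(P)` of a point. -/
def Conic.polar (Φ : Conic) (P : Point) : Line :=
  (Matrix.toBilin' Φ.M).orthogonal P.submodule

/-- The pole of a line. -/
def Conic.pole (Φ : Conic) (p : Line) : Point :=
  Classical.epsilon fun P : Point => Φ.polar P = p

/-- The line `p` is tangent to the conic: it is the polar of one of the points of the conic. -/
def Conic.Tangent (Φ : Conic) (p : Line) : Prop :=
  ∃ P : Point, Φ.Contains P ∧ p = Φ.polar P

/-- The conjugate point `Q_p = p · ρ(Q)` of `Q` in the line `p`. -/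
def Conic.conj (Φ : Conic) (p : Line) (Q : Point) : Point := meet p (Φ.polar Q)

/-! ### Midpoints and the (unsquared) trigonometric ratios -/

/-- `Q` is one of the two midpoints of the segment `AB`, whose endpoints are different points
off the conic.  If the line `AB` is not tangent, let `P` be its pole, let `A₁, A₂` and `B₁, B₂`
be the intersections with the conic of the lines `PA` and `PB`; the midpoints are the diagonal
points other than `P` of the quadrangle `A₁, A₂, B₁, B₂`.  If `AB` is tangent at `R`, the
midpoints are `R` and the harmonic conjugate of `R` with respect to `A, B`. -/
def Conic.IsMidpoint (Φ : Conic) (A B Q : Point) : Prop :=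
  A ≠ B ∧ ¬ Φ.Contains A ∧ ¬ Φ.Contains B ∧
  ((¬ Φ.Tangent (join A B) ∧
      ∃ A₁ A₂ B₁ B₂ : Point,
        A₁ ≠ A₂ ∧ Φ.Contains A₁ ∧ Φ.Contains A₂ ∧
        On A₁ (join (Φ.pole (join A B)) A) ∧ On A₂ (join (Φ.pole (join A B)) A) ∧
        B₁ ≠ B₂ ∧ Φ.Contains B₁ ∧ Φ.Contains B₂ ∧
        On B₁ (join (Φ.pole (join A B)) B) ∧ On B₂ (join (Φ.pole (join A B)) B) ∧
        On Q (join A₁ B₁) ∧ On Q (join A₂ B₂)) ∨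
    ∃ R : Point, Φ.Contains R ∧ join A B = Φ.polar R ∧
      (Q = R ∨ (On Q (join A B) ∧ crossRatio A B R Q = -1)))

/-- `cc(AB) = (A B B_p D)`, where `p = AB` and `D` is the preferred midpoint of `AB`. -/
def Conic.cc (Φ : Conic) (A B D : Point) : ℂ :=
  crossRatio A B (Φ.conj (join A B) B) D

/-- `ss(AB) = (A B_p B G)`, where `p = AB` and `G` is the preferred complementary midpoint
of `AB` (a midpoint of `A B_p`). -/
def Conic.ss (Φ : Conic) (A B G : Point) : ℂ :=
  crossRatio A (Φ.conj (join A B) B) B G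

/-! ### Triangles

The vertices `A, B, C` of a triangle are `T 0, T 1, T 2`; the sides `a = BC`, `b = CA`,
`c = AB` are `side T 0, side T 1, side T 2` (indices are taken modulo three). -/

/-- The side of `T` opposite to the vertex `T i`. -/
def side (T : Fin 3 → Point) (i : Fin 3) : Line := join (T (i + 1)) (T (i + 2))

/-- The polar triangle `T'`: its vertices `A', B', C'` are the poles of `a, b, c`. -/
def Conic.polarTriangle (Φ : Conic) (T : Fin 3 → Point) : Fin 3 → Point :=
  fun i => Φ.pole (side T i)

/-- `T` is a triangle (its vertices are not collinear) in general position: the vertices and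
sides of `T` and of its polar triangle are all different, and no vertex of either is on the
conic. -/
structure Conic.GeneralPosition (Φ : Conic) (T : Fin 3 → Point) : Prop where
  noncollinear : Projectivization.Independent T
  vertices_ne : ∀ i j, T i ≠ Φ.polarTriangle T j
  sides_ne : ∀ i j, side T i ≠ side (Φ.polarTriangle T) j
  vertex_off : ∀ i, ¬ Φ.Contains (T i)
  polar_vertex_off : ∀ i, ¬ Φ.Contains (Φ.polarTriangle T i)

/-- `T` is right-angled: two of its sides are conjugate, i.e. one of them contains the pole of
the other. -/
def Conic.RightAngled (Φ : Conic) (T : Fin 3 → Point) : Prop :=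
  ∃ i j, i ≠ j ∧ On (Φ.polarTriangle T i) (side T j)

/-- An orientation of the three sides of `T`: a preferred midpoint `mid i` and a preferred
complementary midpoint `comp i` of each of the segments `BC`, `CA`, `AB`.
The complementary midpoints of `AB` are the midpoints of `A B_c`. -/
structure Conic.Orientation (Φ : Conic) (T : Fin 3 → Point) where
  mid : Fin 3 → Point
  comp : Fin 3 → Point
  isMid : ∀ i, Φ.IsMidpoint (T (i + 1)) (T (i + 2)) (mid i)
  isComp : ∀ i, Φ.IsMidpoint (T (i + 1)) (Φ.conj (side T i) (T (i + 2))) (comp i)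

/-- `cc(BC), cc(CA), cc(AB)` for `i = 0, 1, 2`. -/
def Conic.Orientation.cc {Φ : Conic} {T : Fin 3 → Point} (o : Φ.Orientation T) (i : Fin 3) : ℂ :=
  Φ.cc (T (i + 1)) (T (i + 2)) (o.mid i)

/-- `ss(BC), ss(CA), ss(AB)` for `i = 0, 1, 2`. -/
def Conic.Orientation.ss {Φ : Conic} {T : Fin 3 → Point} (o : Φ.Orientation T) (i : Fin 3) : ℂ :=
  Φ.ss (T (i + 1)) (T (i + 2)) (o.comp i)

/-- `Q` is a magic midpoint of `T` on the line `B_c C_b` (for `i = 0`), `C_a A_c` (for `i = 1`),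
`A_b B_a` (for `i = 2`): a midpoint of the segment with these endpoints. -/
def Conic.IsMagicMidpoint (Φ : Conic) (T : Fin 3 → Point) (i : Fin 3) (Q : Point) : Prop :=
  Φ.IsMidpoint (Φ.conj (side T (i + 2)) (T (i + 1))) (Φ.conj (side T (i + 1)) (T (i + 2))) Q

/-- The triangle `T`, whose sides are oriented by `o` (midpoints `D, E, F`, complementary
midpoints `G, H, I`) and the sides of whose polar triangle are oriented by `o'` (midpoints
`D', E', F'`, complementary midpoints `G', H', I'`), is coherently oriented:
`D, E, F` are not collinear and differ from `A₀ = a · a'`, `B₀ = b · b'`, `C₀ = c · c'`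
respectively, the same holds for `D', E', F'`, and there are noncollinear magic midpoints, one
on each of the lines `B_c C_b`, `C_a A_c`, `A_b B_a`, the first of which is on the lines `DD'`,
`HI`, `H'I'`, the second on `EE'`, `IG`, `I'G'`, and the third on `FF'`, `GH`, `G'H'`. -/
structure Conic.CoherentlyOriented (Φ : Conic) (T : Fin 3 → Point) (o : Φ.Orientation T)
    (o' : Φ.Orientation (Φ.polarTriangle T)) : Prop where
  mid_noncollinear : Projectivization.Independent o.mid
  mid_ne : ∀ i, o.mid i ≠ meet (side T i) (side (Φ.polarTriangle T) i)
  mid'_noncollinear : Projectivization.Independent o'.mid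
  mid'_ne : ∀ i, o'.mid i ≠ meet (side T i) (side (Φ.polarTriangle T) i)
  magic : ∃ m : Fin 3 → Point, Projectivization.Independent m ∧
    ∀ i, Φ.IsMagicMidpoint T i (m i) ∧
      On (m i) (join (o.mid i) (o'.mid i)) ∧
      On (m i) (join (o.comp (i + 1)) (o.comp (i + 2))) ∧
      On (m i) (join (o'.comp (i + 1)) (o'.comp (i + 2)))

/-! ### Real elements and the non-euclidean magnitudes -/

/-- The point has real homogeneous coordinates. -/
def IsRealPoint (P : Point) : Prop :=
  ∃ (v : Fin 3 → ℝ) (h : (fun i => (v i : ℂ)) ≠ (0 : Vec)),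
    P = Projectivization.mk ℂ (fun i => (v i : ℂ)) h

/-- The conic has an equation with real coefficients. -/
def Conic.HasRealEquation (Φ : Conic) : Prop :=
  ∃ c : ℂ, c ≠ 0 ∧ ∀ i j, (c * Φ.M i j).im = 0

/-- The conic has no real points (the elliptic case). -/
def Conic.IsImaginary (Φ : Conic) : Prop := ∀ P, IsRealPoint P → ¬ Φ.Contains P

/-- A real line is exterior to the conic: it contains no real point of the conic. -/
def Conic.ExteriorLine (Φ : Conic) (p : Line) : Prop :=
  ∀ P, IsRealPoint P → On P p → ¬ Φ.Contains P

/-- A real line is secant to the conic: it contains two real points of the conic. -/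
def Conic.SecantLine (Φ : Conic) (p : Line) : Prop :=
  ∃ U V : Point, U ≠ V ∧ IsRealPoint U ∧ IsRealPoint V ∧ On U p ∧ On V p ∧
    Φ.Contains U ∧ Φ.Contains V

/-- A real point off the conic is interior to the conic: its polar is an exterior line. -/
def Conic.Interior (Φ : Conic) (P : Point) : Prop := Φ.ExteriorLine (Φ.polar P)

/-- `U, V` are the two intersection points of the line `p` with the conic. -/
def Conic.Cuts (Φ : Conic) (p : Line) (U V : Point) : Prop :=
  U ≠ V ∧ On U p ∧ On V p ∧ Φ.Contains U ∧ Φ.Contains V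

/-- `d = ½ log (UVXY)`, where `U, V` are the intersection points of the line `p ∋ X, Y` with the
conic, labelled so that `d ≥ 0`: the hyperbolic distance between the points `X, Y` of `p`. -/
def Conic.IsDist (Φ : Conic) (p : Line) (X Y : Point) (d : ℝ) : Prop :=
  0 ≤ d ∧ ∃ U V : Point, Φ.Cuts p U V ∧ Complex.exp (2 * (d : ℂ)) = crossRatio U V X Y

/-- `θ = (1 / 2i) log (UVXY)` with `0 < θ < π`, where `U, V` are the intersection points of the
line `p ∋ X, Y` with the conic, in any order.  It is an elliptic distance between `X` and `Y`
and also the (Laguerre) angle between the lines joining `X` and `Y` to the pole of `p`; it is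
determined up to interchanging `θ` and `π - θ`. -/
def Conic.IsAngle (Φ : Conic) (p : Line) (X Y : Point) (θ : ℝ) : Prop :=
  0 < θ ∧ θ < Real.pi ∧
    ∃ U V : Point, Φ.Cuts p U V ∧
      Complex.exp (2 * (θ : ℂ) * Complex.I) = crossRatio U V X Y

/-- The non-euclidean translation of a real segment: its magnitude `m` (a distance or an angle),
the cosine-like function `C` and the sine-like function `S` of the magnitude (`cos m` and
`sin m`, `cosh m` and `sinh m`, or `sinh m` and `cosh m`), and the units `u, v ∈ {1, i}` such
that `cc = ± u C` and `ss = ± v S`. -/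
structure Translation where
  m : ℝ
  C : ℝ
  S : ℝ
  u : ℂ
  v : ℂ

/-- The translation of the real segment `XY` with underlying line `p`, according to the position
of `X, Y, p` with respect to the conic: if `p` has no real points on the conic, the magnitude is
an angle (or elliptic distance); otherwise it is the hyperbolic distance between the interior
ones among `X, X_p` and among `Y, Y_p`. -/
inductive Conic.Translates (Φ : Conic) (X Y : Point) : Translation → Prop
  | angle (θ : ℝ) : Φ.ExteriorLine (join X Y) → Φ.IsAngle (join X Y) X Y θ →
      Translates Φ X Y ⟨θ, Real.cos θ, Real.sin θ, 1, 1⟩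
  | intInt (d : ℝ) : Φ.SecantLine (join X Y) → Φ.Interior X → Φ.Interior Y →
      Φ.IsDist (join X Y) X Y d →
      Translates Φ X Y ⟨d, Real.cosh d, Real.sinh d, 1, Complex.I⟩
  | extExt (d : ℝ) : Φ.SecantLine (join X Y) → ¬ Φ.Interior X → ¬ Φ.Interior Y →
      Φ.IsDist (join X Y) (Φ.conj (join X Y) X) (Φ.conj (join X Y) Y) d →
      Translates Φ X Y ⟨d, Real.cosh d, Real.sinh d, 1, Complex.I⟩
  | intExt (d : ℝ) : Φ.SecantLine (join X Y) → Φ.Interior X → ¬ Φ.Interior Y →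
      Φ.IsDist (join X Y) X (Φ.conj (join X Y) Y) d →
      Translates Φ X Y ⟨d, Real.sinh d, Real.cosh d, Complex.I, 1⟩
  | extInt (d : ℝ) : Φ.SecantLine (join X Y) → ¬ Φ.Interior X → Φ.Interior Y →
      Φ.IsDist (join X Y) (Φ.conj (join X Y) X) Y d →
      Translates Φ X Y ⟨d, Real.sinh d, Real.cosh d, Complex.I, 1⟩

/-- `t 0, t 1, t 2` are translations of the sides `BC`, `CA`, `AB` of `T`, and for every
orientation of the sides of `T` the trigonometric ratios are `± u C` and `± v S`. -/
def Conic.TranslatesSides (Φ : Conic) (T : Fin 3 → Point) (t : Fin 3 → Translation) : Prop :=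
  (∀ i, Φ.Translates (T (i + 1)) (T (i + 2)) (t i)) ∧
  ∀ (o : Φ.Orientation T) (i : Fin 3),
    (o.cc i = (t i).u * (t i).C ∨ o.cc i = -((t i).u * (t i).C)) ∧
    (o.ss i = (t i).v * (t i).S ∨ o.ss i = -((t i).v * (t i).S))

/-- The laws of cosines of an elliptic triangle with sides `a, b, c = (t i).m` and angles
`α, β, γ = (t' i).m`: `cos a = cos b cos c + sin b sin c cos α`,
`cos α = - cos β cos γ + sin β sin γ cos a`, and their cyclic permutations. -/
def EllipticLaws (t t' : Fin 3 → Translation) : Prop :=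
  ∀ i : Fin 3,
    (t i).C = (t (i + 1)).C * (t (i + 2)).C + (t (i + 1)).S * (t (i + 2)).S * (t' i).C ∧
    (t' i).C = -((t' (i + 1)).C * (t' (i + 2)).C) +
      (t' (i + 1)).S * (t' (i + 2)).S * (t i).C

/-- The sign of a real point off a real conic: `-1` for interior and `1` for exterior points. -/
def Conic.sgn (Φ : Conic) (P : Point) : ℝ :=
  open Classical in if Φ.Interior P then -1 else 1

/-- The laws of cosines of the hyperbolic generalized triangles produced by `T` and its polar
triangle.  A sign is attached to each of the six magnitudes, the same one in all the six laws,
and it is `+` for the distances between two interior vertices of `T` or of `T'`; with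
`X i, X' i` the signed cosine-like functions, the laws are
`± X_a = - X_b X_c + S_b S_c X'_α` with the sign of the vertex `A`,
`± X'_α = - X'_β X'_γ + S'_β S'_γ X_a` with the sign of the vertex `A'`,
and their cyclic permutations.  For an ordinary hyperbolic triangle these are
`cosh a = cosh b cosh c - sinh b sinh c cos α` and
`cos α = - cos β cos γ + sin β sin γ cosh a`. -/
def Conic.HyperbolicLaws (Φ : Conic) (T : Fin 3 → Point) (t t' : Fin 3 → Translation) : Prop :=
  ∃ σ σ' : Fin 3 → ℝ,
    (∀ i, (σ i = 1 ∨ σ i = -1) ∧ (σ' i = 1 ∨ σ' i = -1)) ∧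
    (∀ i, Φ.Interior (T (i + 1)) → Φ.Interior (T (i + 2)) → σ i = 1) ∧
    (∀ i, Φ.Interior (Φ.polarTriangle T (i + 1)) → Φ.Interior (Φ.polarTriangle T (i + 2)) →
      σ' i = 1) ∧
    ∀ i : Fin 3,
      Φ.sgn (T i) * (σ i * (t i).C) =
        -((σ (i + 1) * (t (i + 1)).C) * (σ (i + 2) * (t (i + 2)).C)) +
          (t (i + 1)).S * (t (i + 2)).S * (σ' i * (t' i).C) ∧
      Φ.sgn (Φ.polarTriangle T i) * (σ' i * (t' i).C) =
        -((σ' (i + 1) * (t' (i + 1)).C) * (σ' (i + 2) * (t' (i + 2)).C)) +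
          (t' (i + 1)).S * (t' (i + 2)).S * (σ i * (t i).C)

end ProjTrig

end

/-! Write `⟨·,·⟩` for the bilinear form of the conic and scale vertex coordinates `x, y` to norm
`1`; each is then determined up to sign. The midpoints of `XY` are `x ± y`, and `cc(XY) = ∓⟨x,y⟩`.
With `g = ⟨x,y⟩` and `s² = 1 - g²`, the conjugate point `Y_p` has the unit vector `(x - g y)/s`, the
complementary midpoints are `x + (δ/s)(x - g y)` with `δ = ±1`, and `ss(XY) = -δ s`. An orientation
is thus a choice of signs.

A triangle and its polar triangle are dual bases up to factors `k_i`, so their Gram matrices satisfy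
`G' = K G⁻¹ K`. Choosing one square root `r` of `det G` and `s_i = r / k_i`, the off-diagonal
entries read `s_b s_c g'_a = g_b g_c - g_a`. This is the law of cosines up to the sign `δ_b δ_c`.
Noncollinearity of the midpoints lets all of them be sums of unit vectors. A magic midpoint is `B_c
+ μ C_b` in unit vectors with `μ = ±1`; its position on `HI` gives `μ δ_b = δ_c`
(`sign_of_magic_on_comp`), and its position on `DD'` gives `μ = 1` (`sign_of_magic_on_mid`). Hence
`δ_b = δ_c`. The magic midpoints of the polar triangle are the same points, so the dual law follows
by symmetry.

In the real case the equation is scaled to negative determinant, so its signature is `(0,3)` or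
`(2,1)` and interior points are exactly those of negative norm. Vertices are normalised to norm `±1`
and `k_i > 0`. The same Gram identity becomes `e_a g_a = g_b g_c + S_b S_c g'_a` (`RealTriple.law`),
with `S = √|e f - g²|`. Elliptic and hyperbolic laws differ only in how `g` is expressed by a
magnitude; the cross ratios with the intersections of the side and the conic (`exists_cuts`) give
this. In the hyperbolic case the remaining freedom is a sign change of the vertices, used to make
the distances between interior vertices positive. -/

open scoped LinearAlgebra.Projectivization

noncomputable section

namespace ProjTrig

section

/-! ### Homogeneous coordinates -/

/-- `v` is a vector of homogeneous coordinates of the point `P`. -/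
def Rep (P : Point) (v : Vec) : Prop := v ≠ 0 ∧ P.submodule = Submodule.span ℂ {v}

theorem exists_rep (P : Point) : ∃ v, Rep P v :=
  ⟨P.rep, P.rep_nonzero, P.submodule_eq⟩

theorem exists_point {v : Vec} (hv : v ≠ 0) : ∃ P, Rep P v :=
  ⟨Projectivization.mk ℂ v hv, hv, Projectivization.submodule_mk v hv⟩

theorem rep_mk {v : Vec} (hv : v ≠ 0) : Rep (Projectivization.mk ℂ v hv) v :=
  ⟨hv, Projectivization.submodule_mk v hv⟩

theorem Rep.eq_mk {P : Point} {v : Vec} (h : Rep P v) : P = Projectivization.mk ℂ v h.1 :=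
  Projectivization.submodule_injective (h.2.trans (Projectivization.submodule_mk v h.1).symm)

theorem Rep.unique {P Q : Point} {v : Vec} (hP : Rep P v) (hQ : Rep Q v) : P = Q :=
  hP.eq_mk.trans hQ.eq_mk.symm

theorem Rep.smul {P : Point} {v : Vec} (h : Rep P v) {c : ℂ} (hc : c ≠ 0) : Rep P (c • v) :=
  ⟨smul_ne_zero hc h.1, by rw [h.2, Submodule.span_singleton_smul_eq (IsUnit.mk0 c hc)]⟩

theorem Rep.exists_smul {P : Point} {v w : Vec} (hv : Rep P v) (hw : Rep P w) :
    ∃ c : ℂ, c ≠ 0 ∧ w = c • v := by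
  have h : w ∈ Submodule.span ℂ {v} := by
    rw [← hv.2, hw.2]; exact Submodule.mem_span_singleton_self w
  obtain ⟨c, rfl⟩ := Submodule.mem_span_singleton.1 h
  refine ⟨c, ?_, rfl⟩
  rintro rfl
  exact hw.1 (zero_smul _ _)

theorem Rep.of_smul {P : Point} {v w : Vec} {c : ℂ} (hw : w ≠ 0) (h : Rep P v) (e : w = c • v) :
    Rep P w := by
  subst e
  refine h.smul ?_
  rintro rfl
  exact hw (zero_smul _ _)

theorem Rep.exists_rep_eq {P : Point} {v : Vec} (h : Rep P v) :
    ∃ c : ℂ, c ≠ 0 ∧ P.rep = c • v :=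
  h.exists_smul ⟨P.rep_nonzero, P.submodule_eq⟩

theorem Rep.on_iff {P : Point} {v : Vec} (h : Rep P v) (p : Line) : On P p ↔ v ∈ p := by
  rw [On, h.2, Submodule.span_singleton_le_iff_mem]

theorem Rep.join_eq {P Q : Point} {v w : Vec} (hv : Rep P v) (hw : Rep Q w) :
    join P Q = Submodule.span ℂ {v, w} := by
  rw [join, hv.2, hw.2, ← Submodule.span_insert]

theorem Rep.linearIndependent {P Q : Point} {v w : Vec} (hv : Rep P v) (hw : Rep Q w)
    (h : P ≠ Q) : LinearIndependent ℂ ![v, w] := by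
  rw [LinearIndependent.pair_iff' hv.1]
  rintro a rfl
  exact h ((hv.of_smul hw.1 rfl).unique hw)

theorem Rep.ne {P Q : Point} {v w : Vec} (hv : Rep P v) (hw : Rep Q w)
    (h : LinearIndependent ℂ ![v, w]) : P ≠ Q := by
  rintro rfl
  obtain ⟨c, -, rfl⟩ := hv.exists_smul hw
  exact (LinearIndependent.pair_iff' hv.1).1 h c rfl

theorem not_independent_of_combination {T : Fin 3 → Point} {v : Fin 3 → Vec}
    (hv : ∀ i, Rep (T i) (v i)) {a b c : ℂ} (ha : a ≠ 0)
    (h : a • v 0 + b • v 1 + c • v 2 = 0) : ¬ Projectivization.Independent T := by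
  intro hT
  rw [Projectivization.independent_iff] at hT
  choose k hk hk' using fun i => (hv i).exists_rep_eq
  rw [Fintype.linearIndependent_iff] at hT
  have := hT ![a / k 0, b / k 1, c / k 2] ?_ 0
  · simp [ha, hk] at this
  · have h0 := hk 0
    have h1 := hk 1
    have h2 := hk 2
    simp only [Fin.sum_univ_three, Function.comp, hk', smul_smul]
    simpa [h0, h1, h2] using h

theorem Rep.independent_iff {T : Fin 3 → Point} {v : Fin 3 → Vec} (hv : ∀ i, Rep (T i) (v i)) :
    Projectivization.Independent T ↔ LinearIndependent ℂ v := by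
  rw [Projectivization.independent_iff]
  choose k hk hk' using fun i => (hv i).exists_rep_eq
  have : Projectivization.rep ∘ T = fun i => (Units.mk0 (k i) (hk i)) • v i := by
    funext i
    simp [hk', Units.smul_def]
  rw [this]
  exact LinearIndependent.units_smul_iff v _

/-! ### The polarity -/

/-- The bilinear form of a conic. -/
def Conic.form (Φ : Conic) : LinearMap.BilinForm ℂ Vec := Matrix.toBilin' Φ.M

theorem Conic.form_nondegenerate (Φ : Conic) : Φ.form.Nondegenerate :=
  LinearMap.BilinForm.nondegenerate_toBilin'_iff_det_ne_zero.2 Φ.nondeg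

theorem Conic.form_comm (Φ : Conic) (x y : Vec) : Φ.form x y = Φ.form y x := by
  simp only [Conic.form, Matrix.toBilin'_apply']
  rw [Matrix.dotProduct_mulVec, ← Matrix.mulVec_transpose, Φ.symm.eq, dotProduct_comm]

theorem Conic.form_isRefl (Φ : Conic) : Φ.form.IsRefl := fun x y h => by
  rw [Φ.form_comm]; exact h

theorem Conic.eq_zero_of_form (Φ : Conic) {x : Vec} (h : ∀ y, Φ.form x y = 0) : x = 0 :=
  Φ.form_nondegenerate.1 x h

variable {Φ : Conic}

theorem Rep.contains_iff {P : Point} {v : Vec} (h : Rep P v) :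
    Φ.Contains P ↔ Φ.form v v = 0 := by
  obtain ⟨c, hc, e⟩ := h.exists_rep_eq
  have : P.rep ⬝ᵥ (Φ.M.mulVec P.rep) = Φ.form P.rep P.rep := by
    rw [Conic.form, Matrix.toBilin'_apply']
  rw [Conic.Contains, this, e]
  simp [hc]

theorem Rep.mem_polar_iff {P : Point} {v w : Vec} (h : Rep P v) :
    w ∈ Φ.polar P ↔ Φ.form v w = 0 := by
  rw [Conic.polar, h.2]
  exact LinearMap.BilinForm.mem_orthogonal_iff.trans
    ⟨fun H => H v (Submodule.mem_span_singleton_self v), fun H n hn => by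
      obtain ⟨c, rfl⟩ := Submodule.mem_span_singleton.1 hn
      change Φ.form (c • v) w = 0
      simp [H]⟩

/-- The double orthogonal complement is the identity. This makes the choice in `Conic.pole`
harmless. -/
theorem Conic.polar_injective (Φ : Conic) : Function.Injective Φ.polar := by
  intro P Q h
  apply Projectivization.submodule_injective
  have hP := LinearMap.BilinForm.orthogonal_orthogonal Φ.form_nondegenerate Φ.form_isRefl P.submodule
  have hQ := LinearMap.BilinForm.orthogonal_orthogonal Φ.form_nondegenerate Φ.form_isRefl Q.submodule
  rw [← hP, ← hQ]
  exact congrArg _ h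

theorem Conic.pole_polar (Φ : Conic) (P : Point) : Φ.pole (Φ.polar P) = P :=
  Φ.polar_injective (Classical.epsilon_spec (p := fun Q => Φ.polar Q = Φ.polar P) ⟨P, rfl⟩)

theorem finrank_span_pair {v w : Vec} (h : LinearIndependent ℂ ![v, w]) :
    Module.finrank ℂ (Submodule.span ℂ {v, w}) = 2 := by
  have := finrank_span_eq_card h
  rwa [Matrix.range_cons_cons_empty] at this

theorem Rep.finrank_polar {P : Point} {v : Vec} (h : Rep P v) :
    Module.finrank ℂ (Φ.polar P) = 2 := by
  have := LinearMap.BilinForm.finrank_orthogonal Φ.form_nondegenerate P.submodule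
  change Module.finrank ℂ (Φ.form.orthogonal P.submodule) = 2
  rw [this, h.2, finrank_span_singleton h.1]
  simp

/-- The line spanned by two independent vectors orthogonal to `n` is the polar of `n`. -/
theorem Rep.polar_eq_span {P : Point} {n v w : Vec} (h : Rep P n)
    (hvw : LinearIndependent ℂ ![v, w]) (hv : Φ.form n v = 0) (hw : Φ.form n w = 0) :
    Φ.polar P = Submodule.span ℂ {v, w} := by
  symm
  have : FiniteDimensional ℂ (Φ.polar P) := inferInstance
  apply Submodule.eq_of_le_of_finrank_eq
  · rw [Submodule.span_le]
    rintro x (rfl | rfl)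
    · exact h.mem_polar_iff.2 hv
    · exact h.mem_polar_iff.2 hw
  · rw [finrank_span_pair hvw, h.finrank_polar]

theorem Conic.exists_orthogonal (Φ : Conic) (v w : Vec) :
    ∃ n : Vec, n ≠ 0 ∧ Φ.form n v = 0 ∧ Φ.form n w = 0 := by
  let f : Vec →ₗ[ℂ] (ℂ × ℂ) := (Φ.form v).prod (Φ.form w)
  have hf : f.ker ≠ ⊥ := LinearMap.ker_ne_bot_of_finrank_lt (by simp)
  obtain ⟨n, hn, hn0⟩ := Submodule.exists_mem_ne_zero_of_ne_bot hf
  have : (Φ.form v n, Φ.form w n) = (0, 0) := hn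
  rw [Prod.mk.injEq] at this
  exact ⟨n, hn0, by rw [Φ.form_comm]; exact this.1, by rw [Φ.form_comm]; exact this.2⟩

theorem Conic.exists_polar_eq_span (Φ : Conic) {v w : Vec} (h : LinearIndependent ℂ ![v, w]) :
    ∃ (P : Point) (n : Vec), Rep P n ∧ Φ.form n v = 0 ∧ Φ.form n w = 0 ∧
      Φ.polar P = Submodule.span ℂ {v, w} := by
  obtain ⟨n, hn, h1, h2⟩ := Φ.exists_orthogonal v w
  obtain ⟨P, hP⟩ := exists_point hn
  exact ⟨P, n, hP, h1, h2, hP.polar_eq_span h h1 h2⟩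

/-- Two vectors orthogonal to the same two independent vectors are proportional. -/
theorem Conic.exists_smul_of_orthogonal (Φ : Conic) {v w x y : Vec}
    (h : LinearIndependent ℂ ![v, w]) (hx : x ≠ 0) (hxv : Φ.form x v = 0) (hxw : Φ.form x w = 0)
    (hyv : Φ.form y v = 0) (hyw : Φ.form y w = 0) : ∃ c : ℂ, y = c • x := by
  by_cases hy : y = 0
  · exact ⟨0, by simp [hy]⟩
  obtain ⟨P, hP⟩ := exists_point hx
  obtain ⟨Q, hQ⟩ := exists_point hy
  have : P = Q := Φ.polar_injective
    ((hP.polar_eq_span h hxv hxw).trans (hQ.polar_eq_span h hyv hyw).symm)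
  subst this
  obtain ⟨c, -, hc⟩ := hP.exists_smul hQ
  exact ⟨c, hc⟩

theorem Rep.pole_eq {P : Point} {n v w : Vec} (h : Rep P n)
    (hvw : LinearIndependent ℂ ![v, w]) (hv : Φ.form n v = 0) (hw : Φ.form n w = 0) :
    Φ.pole (Submodule.span ℂ {v, w}) = P := by
  rw [← h.polar_eq_span hvw hv hw, Φ.pole_polar]

/-- The polars of two different points meet in the point conjugate to both. -/
theorem meet_polar {P Q X : Point} {v w x : Vec} (hP : Rep P v) (hQ : Rep Q w) (hX : Rep X x)
    (hvw : LinearIndependent ℂ ![v, w]) (hv : Φ.form v x = 0) (hw : Φ.form w x = 0) :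
    meet (Φ.polar P) (Φ.polar Q) = X := by
  have key : X.submodule = Φ.polar P ⊓ Φ.polar Q := by
    apply le_antisymm
    · rw [hX.2, Submodule.span_singleton_le_iff_mem]
      exact ⟨hP.mem_polar_iff.2 hv, hQ.mem_polar_iff.2 hw⟩
    · rintro y ⟨h1, h2⟩
      have h1 := hP.mem_polar_iff.1 h1
      have h2 := hQ.mem_polar_iff.1 h2
      rw [Φ.form_comm] at h1 h2 hv hw
      obtain ⟨c, rfl⟩ := Φ.exists_smul_of_orthogonal hvw hX.1 hv hw h1 h2
      rw [hX.2]
      exact Submodule.smul_mem _ _ (Submodule.mem_span_singleton_self _)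
  apply Projectivization.submodule_injective
  rw [key]
  exact Classical.epsilon_spec (p := fun R : Point => R.submodule = Φ.polar P ⊓ Φ.polar Q) ⟨X, key⟩

theorem form_ne_of_independent {v w : Vec} (hv : Φ.form v v ≠ 0) (hw : w ≠ 0)
    (h : Φ.form v w = 0) : LinearIndependent ℂ ![v, w] := by
  rw [LinearIndependent.pair_iff]
  intro s t hst
  have hs : s = 0 := by
    have := congrArg (Φ.form v) hst
    simpa [h, hv] using this
  subst hs
  simpa [hw] using hst

/-- Homogeneous coordinates of the point conjugate to `Y` on the line `XY`. -/
theorem Rep.conj {Y : Point} {x y : Vec} (hY : Rep Y y)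
    (h : LinearIndependent ℂ ![x, y]) (hy : Φ.form y y ≠ 0) :
    Rep (Φ.conj (Submodule.span ℂ {x, y}) Y) (Φ.form y y • x - Φ.form x y • y) := by
  have hne : Φ.form y y • x - Φ.form x y • y ≠ 0 := by
    intro h0
    have := (LinearIndependent.pair_iff.1 h) (Φ.form y y) (-Φ.form x y) (by
      rw [neg_smul, ← sub_eq_add_neg]; exact h0)
    exact hy this.1
  obtain ⟨Q, hQ⟩ := exists_point hne
  obtain ⟨P, n, hP, h1, h2, hp⟩ := Φ.exists_polar_eq_span h
  rw [Conic.conj, ← hp]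
  rw [meet_polar hP hY hQ]
  · exact hQ
  · rw [LinearIndependent.pair_symm_iff]
    exact form_ne_of_independent hy hP.1 (by rw [Φ.form_comm]; exact h2)
  · simp [h1, h2]
  · simp [Φ.form_comm y x]; ring

theorem Rep.conj_left {X : Point} {x y : Vec} (hX : Rep X x)
    (h : LinearIndependent ℂ ![x, y]) (hx : Φ.form x x ≠ 0) :
    Rep (Φ.conj (Submodule.span ℂ {x, y}) X) (Φ.form x x • y - Φ.form x y • x) := by
  rw [Set.pair_comm, Φ.form_comm x y]
  exact hX.conj (LinearIndependent.pair_symm_iff.1 h) hx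

/-! ### Cross ratios -/

theorem bracket_combination (x y o : Vec) (a b c d : ℂ) :
    bracket o (a • x + b • y) (c • x + d • y) = (a * d - b * c) * bracket o x y := by
  simp only [bracket, Matrix.det_fin_three]
  simp
  ring

-- The determinant is the squared Hermitian norm of `x × y`. Without the conjugation it would be a
-- bilinear square, which can vanish on nonzero complex vectors.
open scoped ComplexOrder in
theorem bracket_star_cross {x y : Vec} (h : LinearIndependent ℂ ![x, y]) :
    bracket (star (crossProduct x y)) x y ≠ 0 := by
  have h1 : crossProduct x y ≠ 0 := crossProduct_ne_zero_iff_linearIndependent.2 h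
  have h2 : bracket (star (crossProduct x y)) x y = star (crossProduct x y) ⬝ᵥ crossProduct x y := by
    rw [triple_product_eq_det]
    change _ = Matrix.det (Matrix.of ![_, _, _])
    simp only [bracket, Matrix.det_fin_three]
    simp
    ring
  rw [h2]
  exact fun h3 => h1 (dotProduct_star_self_eq_zero.1 h3)

/-- The cross ratio `(X Y C D)` in terms of coordinates with respect to `X, Y`. -/
theorem crossRatio_eq {X Y C D : Point} {x y : Vec} (hX : Rep X x) (hY : Rep Y y)
    (h : LinearIndependent ℂ ![x, y]) {a b c d : ℂ} (hC : Rep C (a • x + b • y))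
    (hD : Rep D (c • x + d • y)) : crossRatio X Y C D = (b * c) / (a * d) := by
  obtain ⟨k, hk, ek⟩ := hX.exists_rep_eq
  obtain ⟨l, hl, el⟩ := hY.exists_rep_eq
  obtain ⟨m, hm, em⟩ := hC.exists_rep_eq
  obtain ⟨n, hn, en⟩ := hD.exists_rep_eq
  have hxy : LinearIndependent ℂ ![X.rep, Y.rep] :=
    Rep.linearIndependent ⟨X.rep_nonzero, X.submodule_eq⟩ ⟨Y.rep_nonzero, Y.submodule_eq⟩
      (hX.ne hY h)
  have hB := bracket_star_cross hxy
  simp only [crossRatio]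
  set o : Vec := star (crossProduct X.rep Y.rep)
  have key : ∀ a b c d : ℂ, bracket o (a • x + b • y) (c • x + d • y) =
      (a * d - b * c) * bracket o x y := bracket_combination x y o
  have e1 := key k 0 (m * a) (m * b)
  have e2 := key 0 l (n * c) (n * d)
  have e3 := key 0 l (m * a) (m * b)
  have e4 := key k 0 (n * c) (n * d)
  have e5 := key k 0 0 l
  simp only [zero_smul, zero_add, add_zero, mul_smul, ← smul_add, ← ek, ← el, ← em, ← en] at e1 e2 e3 e4 e5
  have hB' : bracket o x y ≠ 0 := by
    intro h0; rw [h0, mul_zero] at e5; exact hB e5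
  rw [e1, e2, e3, e4]
  -- If `a d = 0`, both denominators vanish and both quotients take the value `0`.
  by_cases hz : a * d = 0
  · rw [hz, div_zero]
    have : (0 * (m * b) - l * (m * a)) * bracket o x y * ((k * (n * d) - 0 * (n * c)) * bracket o x y) = 0 := by
      linear_combination (-l * m * k * n * bracket o x y ^ 2) * hz
    rw [this, div_zero]
  · have := mul_ne_zero_iff.1 hz
    have ha := this.1
    have hd := this.2
    simp only [zero_mul, zero_sub, sub_zero]
    field_simp

end

section

variable {Φ : Conic}

/-! ### Midpoints -/

theorem Conic.form_combination (Φ : Conic) (x y : Vec) (a b c d : ℂ) :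
    Φ.form (a • x + b • y) (c • x + d • y) =
      a * c * Φ.form x x + (a * d + b * c) * Φ.form x y + b * d * Φ.form y y := by
  simp [Φ.form_comm y x]
  ring

/-- Since `P` is off the conic, `Q ≠ P`; so the coefficient of `x` can be scaled to `1`. -/
theorem exists_isotropic_rep {P A Q : Point} {n x : Vec} (hP : Rep P n) (hA : Rep A x)
    (hnx : Φ.form n x = 0) (hn : Φ.form n n ≠ 0)
    (hQ : Φ.Contains Q) (hQ' : On Q (join P A)) :
    ∃ s : ℂ, s ^ 2 * Φ.form n n = -Φ.form x x ∧ Rep Q (x + s • n) := by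
  obtain ⟨q, hq⟩ := exists_rep Q
  rw [hP.join_eq hA, hq.on_iff, Submodule.mem_span_pair] at hQ'
  obtain ⟨a, b, rfl⟩ := hQ'
  have h0 := hq.contains_iff.1 hQ
  rw [Φ.form_combination, hnx] at h0
  have hb : b ≠ 0 := by
    rintro rfl
    have ha : a = 0 := by simpa [hn] using h0
    exact hq.1 (by simp [ha])
  refine ⟨a / b, ?_, ?_⟩
  · field_simp
    linear_combination h0
  · have := hq.smul (inv_ne_zero hb)
    rw [smul_add, smul_smul, smul_smul, inv_mul_cancel₀ hb, one_smul, add_comm,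
      inv_mul_eq_div] at this
    exact this

/-- The contact point is orthogonal to both `x` and `y`, which have equal norms; this forces it to
be `x + y` or `x - y`. The harmonic conjugate is the other one. -/
theorem isMidpoint_of_tangent {A B Q R : Point} {x y : Vec} {e : ℂ} (hA : Rep A x) (hB : Rep B y)
    (hxy : LinearIndependent ℂ ![x, y]) (hx : Φ.form x x = e) (hy : Φ.form y y = e) (he : e ≠ 0)
    (hR : join A B = Φ.polar R) (hRc : Φ.Contains R)
    (h : Q = R ∨ On Q (join A B) ∧ crossRatio A B R Q = -1) :
    Rep Q (x + y) ∨ Rep Q (x - y) := by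
  have hxy' := LinearIndependent.pair_iff.1 hxy
  obtain ⟨r, hr⟩ := exists_rep R
  have hmem : r ∈ join A B := by rw [hR]; exact hr.mem_polar_iff.2 (hr.contains_iff.1 hRc)
  rw [hA.join_eq hB] at hR hmem
  obtain ⟨a, b, rfl⟩ := Submodule.mem_span_pair.1 hmem
  have h1 : Φ.form (a • x + b • y) x = 0 :=
    hr.mem_polar_iff.1 (hR ▸ Submodule.subset_span (by simp))
  have h2 : Φ.form (a • x + b • y) y = 0 :=
    hr.mem_polar_iff.1 (hR ▸ Submodule.subset_span (by simp))
  simp only [map_add, map_smul, LinearMap.add_apply, LinearMap.smul_apply, smul_eq_mul, hx, hy,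
    Φ.form_comm y x] at h1 h2
  have hab : (a - b) * (a + b) = 0 := by
    apply (mul_eq_zero.1 (_ : e * ((a - b) * (a + b)) = 0)).resolve_left he
    linear_combination a * h1 - b * h2
  have ha : a ≠ 0 := by
    rintro rfl
    have : b = 0 := by simpa using hab
    exact hr.1 (by simp [this])
  have hb : b ≠ 0 := by
    rintro rfl
    exact ha (by simpa using hab)
  have hpm : b = a ∨ b = -a := by
    rcases mul_eq_zero.1 hab with h | h
    · left; linear_combination -h
    · right; linear_combination h
  rcases h with rfl | ⟨hQ, hcr⟩
  · have := hr.smul (inv_ne_zero ha)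
    rcases hpm with rfl | rfl
    · left; rwa [smul_add, smul_smul, smul_smul, inv_mul_cancel₀ ha, one_smul, one_smul] at this
    · right
      rwa [smul_add, smul_smul, smul_smul, mul_neg, inv_mul_cancel₀ ha, neg_smul, one_smul,
        one_smul, ← sub_eq_add_neg] at this
  · obtain ⟨q, hq⟩ := exists_rep Q
    rw [hA.join_eq hB, hq.on_iff, Submodule.mem_span_pair] at hQ
    obtain ⟨c, d, rfl⟩ := hQ
    rw [crossRatio_eq hA hB hxy hr hq] at hcr
    have hd : d ≠ 0 := by
      rintro rfl
      simp at hcr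
    have hcd : b * c = -(a * d) := by
      field_simp at hcr
      exact hcr
    rcases hpm with rfl | rfl
    · right
      have hc : c = -d := mul_left_cancel₀ ha (by linear_combination hcd)
      subst hc
      refine hq.of_smul (c := -d⁻¹) ?_ ?_
      · intro h0
        have := (hxy' 1 (-1) (by simpa [sub_eq_add_neg] using h0)).1
        simp at this
      · simp [smul_smul, hd, sub_eq_add_neg]
    · left
      have hc : c = d := mul_left_cancel₀ ha (by linear_combination -hcd)
      subst hc
      refine hq.of_smul (c := c⁻¹) ?_ ?_
      · intro h0
        have := (hxy' 1 1 (by simpa using h0)).1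
        simp at this
      · simp [smul_smul, hd]

/-- The midpoints of a segment whose endpoints have coordinates of the same norm. -/
theorem Conic.IsMidpoint.rep {A B Q : Point} {x y : Vec} {e : ℂ} (h : Φ.IsMidpoint A B Q)
    (hA : Rep A x) (hB : Rep B y) (hx : Φ.form x x = e) (hy : Φ.form y y = e) :
    Rep Q (x + y) ∨ Rep Q (x - y) := by
  obtain ⟨hne, hAc, hBc, h⟩ := h
  have hxy := hA.linearIndependent hB hne
  have he : e ≠ 0 := by rw [← hx]; exact fun h => hAc (hA.contains_iff.2 h)
  rcases h with ⟨htan, A₁, A₂, B₁, B₂, hA12, hA₁, hA₂, hA₁', hA₂', hB12, hB₁, hB₂, hB₁', hB₂', hQ1, hQ2⟩ |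
    ⟨R, hRc, hR, hQ⟩
  swap
  · exact isMidpoint_of_tangent hA hB hxy hx hy he hR hRc hQ
  obtain ⟨P, n, hP, hnx, hny, hp⟩ := Φ.exists_polar_eq_span hxy
  have hn : Φ.form n n ≠ 0 := fun h0 => htan ⟨P, hP.contains_iff.2 h0, by rw [hA.join_eq hB, hp]⟩
  have hpole : Φ.pole (join A B) = P := by rw [hA.join_eq hB, ← hp, Φ.pole_polar]
  rw [hpole] at hA₁' hA₂' hB₁' hB₂'
  obtain ⟨s, hs, ra1⟩ := exists_isotropic_rep hP hA hnx hn hA₁ hA₁'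
  obtain ⟨s', hs', ra2⟩ := exists_isotropic_rep hP hA hnx hn hA₂ hA₂'
  obtain ⟨t, ht, rb1⟩ := exists_isotropic_rep hP hB hny hn hB₁ hB₁'
  obtain ⟨t', ht', rb2⟩ := exists_isotropic_rep hP hB hny hn hB₂ hB₂'
  have hsq : ∀ {u w : ℂ}, u ^ 2 * Φ.form n n = -e → w ^ 2 * Φ.form n n = -e → u = w ∨ u = -w := by
    intro u w hu hw
    exact sq_eq_sq_iff_eq_or_eq_neg.1 (mul_right_cancel₀ hn (hu.trans hw.symm))
  rw [hx] at hs hs'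
  rw [hy] at ht ht'
  -- The two intersections on a line through `P` belong to the two roots of one quadratic, and they
  -- are different points.
  have es : s' = -s := (hsq hs' hs).resolve_left fun h => hA12 (ra1.unique (h ▸ ra2))
  have et : t' = -t := (hsq ht' ht).resolve_left fun h => hB12 (rb1.unique (h ▸ rb2))
  subst es et
  have hs0 : s ≠ 0 := by rintro rfl; simp at hs; exact he hs
  obtain ⟨q, hq⟩ := exists_rep Q
  rw [ra1.join_eq rb1, hq.on_iff, Submodule.mem_span_pair] at hQ1
  rw [ra2.join_eq rb2, hq.on_iff, Submodule.mem_span_pair] at hQ2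
  obtain ⟨a, b, hab⟩ := hQ1
  obtain ⟨c, d, hcd⟩ := hQ2
  have hn1 := congrArg (Φ.form n) hab
  have hn2 := congrArg (Φ.form n) hcd
  simp only [map_add, map_smul, smul_eq_mul, hnx, hny, zero_add] at hn1 hn2
  -- Pairing with `n` compares the `n`-components of the two expressions for `q`; the remaining
  -- components then agree by independence of `x, y`.
  have e0 : a * s + b * t = -(c * s + d * t) := by
    apply mul_right_cancel₀ hn
    linear_combination hn1 - hn2
  have e1 : (a - c) • x + (b - d) • y = 0 := by
    have h3 : a • (x + s • n) + b • (y + t • n) - (c • (x + -s • n) + d • (y + -t • n)) = 0 := by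
      rw [hab, hcd, sub_self]
    rw [← h3]
    have h4 : (a * s + b * t + (c * s + d * t)) • n = 0 := by rw [e0]; simp
    linear_combination (norm := module) -h4
  obtain ⟨hac, hbd⟩ := LinearIndependent.pair_iff.1 hxy _ _ e1
  have hac : c = a := by linear_combination -hac
  have hbd : d = b := by linear_combination -hbd
  subst hac hbd
  have e2 : c * s + d * t = 0 := by linear_combination e0 / 2
  have eq : q = c • x + d • y := by
    rw [← hab]
    have h4 : (c * s + d * t) • n = 0 := by rw [e2]; simp
    linear_combination (norm := module) h4
  -- The labelling of `B₁, B₂` relative to `A₁, A₂` decides between the two midpoints: `t = s` gives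
  -- `x - y`, `t = -s` gives `x + y`.
  rcases hsq ht hs with rfl | rfl
  · right
    have : d = -c := mul_right_cancel₀ hs0 (by linear_combination e2)
    subst this
    have hc : c ≠ 0 := by rintro rfl; exact hq.1 (by simp [eq])
    have := hq.smul (inv_ne_zero hc)
    rwa [eq, smul_add, smul_smul, smul_smul, mul_neg, inv_mul_cancel₀ hc, neg_smul, one_smul,
      one_smul, ← sub_eq_add_neg] at this
  · left
    have : d = c := mul_right_cancel₀ hs0 (by linear_combination -e2)
    subst this
    have hc : d ≠ 0 := by rintro rfl; exact hq.1 (by simp [eq])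
    have := hq.smul (inv_ne_zero hc)
    rwa [eq, smul_add, smul_smul, smul_smul, inv_mul_cancel₀ hc, one_smul, one_smul] at this

/-- The midpoints of a segment, with a sign in a uniform notation. -/
theorem Conic.IsMidpoint.exists_sign {A B Q : Point} {x y : Vec} {e : ℂ} (h : Φ.IsMidpoint A B Q)
    (hA : Rep A x) (hB : Rep B y) (hx : Φ.form x x = e) (hy : Φ.form y y = e) :
    ∃ ε : ℂ, ε * ε = 1 ∧ Rep Q (x + ε • y) := by
  rcases h.rep hA hB hx hy with h | h
  · exact ⟨1, by simp, by simpa using h⟩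
  · exact ⟨-1, by simp, by simpa [sub_eq_add_neg] using h⟩

/-! ### The trigonometric ratios -/

/-- In the basis `x, y` the conjugate point is `x - g y` and the midpoint `x + ε y`, whence the
cross ratio `-g / ε`. -/
theorem cc_eq {X Y D : Point} {x y : Vec} {ε : ℂ} (hX : Rep X x) (hY : Rep Y y) (hne : X ≠ Y)
    (hy : Φ.form y y = 1) (hε : ε * ε = 1) (hD : Rep D (x + ε • y)) :
    Φ.cc X Y D = -(ε * Φ.form x y) := by
  have hxy := hX.linearIndependent hY hne
  have hc := hY.conj hxy (by rw [hy]; exact one_ne_zero)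
  have hε0 : ε ≠ 0 := left_ne_zero_of_mul_eq_one hε
  rw [hy, sub_eq_add_neg, ← neg_smul] at hc
  rw [← one_smul ℂ x] at hD
  rw [Conic.cc, hX.join_eq hY, crossRatio_eq hX hY hxy hc hD]
  field_simp
  linear_combination Φ.form x y * hε

/-- The complementary midpoints of a segment whose endpoints have coordinates of norm `1`. -/
theorem Conic.IsMidpoint.exists_sign_conj {X Y G : Point} {x y : Vec} {s : ℂ}
    (hX : Rep X x) (hY : Rep Y y) (hne : X ≠ Y)
    (hx : Φ.form x x = 1) (hy : Φ.form y y = 1) (hs : s ^ 2 = 1 - Φ.form x y ^ 2) (hs0 : s ≠ 0)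
    (hG : Φ.IsMidpoint X (Φ.conj (join X Y) Y) G) :
    Φ.form x y ≠ 0 ∧
    ∃ δ : ℂ, δ * δ = 1 ∧ Rep G (x + (δ / s) • (x - Φ.form x y • y)) ∧
      Φ.ss X Y G = -(δ * s) := by
  have hxy := hX.linearIndependent hY hne
  have hc := hY.conj hxy (by rw [hy]; exact one_ne_zero)
  rw [hy, one_smul] at hc
  have hc' := hc.smul (inv_ne_zero hs0)
  rw [← hX.join_eq hY] at hc hc'
  set g := Φ.form x y with hg
  have hq : Φ.form (s⁻¹ • (x - g • y)) (s⁻¹ • (x - g • y)) = 1 := by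
    simp [hx, hy, Φ.form_comm y x, ← hg]
    field_simp
    linear_combination -hs
  -- If `g = 0`, then `Y_p = X`, and the segment `X Y_p` would have no midpoints.
  have hg0 : g ≠ 0 := by
    intro h0
    rw [h0, zero_smul, sub_zero] at hc
    exact hG.1 (hX.unique hc)
  obtain ⟨δ, hδ, hr⟩ := hG.exists_sign hX hc' hx hq
  have hδ0 : δ ≠ 0 := left_ne_zero_of_mul_eq_one hδ
  refine ⟨hg0, δ, hδ, by rwa [smul_smul, ← div_eq_mul_inv] at hr, ?_⟩
  have hind := hX.linearIndependent hc' hG.1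
  -- `Y` in the basis formed by `x` and the unit vector of `Y_p`: the combination equals `g y`.
  have hY' : Rep Y ((1 : ℂ) • x + (-s) • s⁻¹ • (x - g • y)) := by
    have : (1 : ℂ) • x + (-s) • s⁻¹ • (x - g • y) = g • y := by
      rw [smul_smul, neg_mul, mul_inv_cancel₀ hs0]
      simp
    rw [this]
    exact hY.smul hg0
  have hr' : Rep G ((1 : ℂ) • x + δ • s⁻¹ • (x - g • y)) := by rwa [one_smul]
  rw [Conic.ss, crossRatio_eq hX hc' hind hY' hr']
  field_simp
  linear_combination hδ

end

section

/-! ### Gram matrices of dual triples of vectors -/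

section Gram

variable {F : Type*} [Field F]

/-- The Gram matrix of three vectors. -/
def gram (N : Matrix (Fin 3) (Fin 3) F) (v : Fin 3 → Fin 3 → F) : Matrix (Fin 3) (Fin 3) F :=
  Matrix.of fun i j => Matrix.toBilin' N (v i) (v j)

theorem mul_mul_transpose_apply (N : Matrix (Fin 3) (Fin 3) F) (v w : Fin 3 → Fin 3 → F)
    (i j : Fin 3) :
    (Matrix.of v * N * (Matrix.of w).transpose) i j = Matrix.toBilin' N (v i) (w j) := by
  rw [Matrix.toBilin'_apply', Matrix.dotProduct_mulVec, Matrix.mul_apply_eq_vecMul]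
  simp only [Matrix.mul_apply, dotProduct, Matrix.vecMul, Matrix.transpose_apply, Matrix.of_apply]

theorem gram_eq (N : Matrix (Fin 3) (Fin 3) F) (v : Fin 3 → Fin 3 → F) :
    gram N v = Matrix.of v * N * (Matrix.of v).transpose := by
  ext i j
  rw [mul_mul_transpose_apply]
  rfl

theorem det_gram (N : Matrix (Fin 3) (Fin 3) F) (v : Fin 3 → Fin 3 → F) :
    (gram N v).det = N.det * (Matrix.of v).det ^ 2 := by
  rw [gram_eq, Matrix.det_mul, Matrix.det_mul, Matrix.det_transpose]
  ring

/-- With `V, W` the coordinate matrices and `K` the diagonal of the `k i`, duality says `V N Wᵀ =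
K`. Then `Vᵀ K⁻¹ W N = 1`, so `G K⁻¹ G' = K`, that is, `G' = K G⁻¹ K`. -/
theorem gram_dual {N : Matrix (Fin 3) (Fin 3) F} (hN : N.IsSymm) {v v' : Fin 3 → Fin 3 → F}
    {k : Fin 3 → F} (hk : ∀ i, k i ≠ 0)
    (h : ∀ i j, Matrix.toBilin' N (v i) (v' j) = if i = j then k i else 0) :
    (gram N v).det ≠ 0 ∧ (gram N v).det • gram N v' =
      Matrix.diagonal k * (gram N v).adjugate * Matrix.diagonal k := by
  set V : Matrix (Fin 3) (Fin 3) F := Matrix.of v with hV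
  set W : Matrix (Fin 3) (Fin 3) F := Matrix.of v' with hW
  have h1 : V * N * W.transpose = Matrix.diagonal k := by
    ext i j
    rw [mul_mul_transpose_apply, h, Matrix.diagonal_apply]
  set L : Matrix (Fin 3) (Fin 3) F := Matrix.diagonal fun i => (k i)⁻¹ with hL
  have hKL : Matrix.diagonal k * L = 1 := by
    rw [hL, Matrix.diagonal_mul_diagonal]
    simp [hk]
  have h2 : N * W.transpose * (L * V) = 1 := by
    have : L * V * (N * W.transpose) = 1 := by
      rw [Matrix.mul_assoc, ← Matrix.mul_assoc V, h1]
      exact mul_eq_one_comm.1 hKL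
    exact mul_eq_one_comm.1 this
  have h3 : V.transpose * L * W * N = 1 := by
    have := congrArg Matrix.transpose h2
    simpa [Matrix.transpose_mul, hN.eq, hL, Matrix.mul_assoc] using this
  have h4 : gram N v * L * gram N v' = Matrix.diagonal k := by
    calc gram N v * L * gram N v' = V * N * (V.transpose * L * W * N) * W.transpose := by
          rw [gram_eq, gram_eq]
          simp only [Matrix.mul_assoc, ← hV, ← hW]
      _ = Matrix.diagonal k := by rw [h3, mul_one, h1]
  have hdetK : (Matrix.diagonal k).det ≠ 0 := by
    rw [Matrix.det_diagonal]
    exact Finset.prod_ne_zero_iff.2 fun i _ => hk i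
  refine ⟨?_, ?_⟩
  · intro h0
    rw [← h4, Matrix.det_mul, Matrix.det_mul, h0, zero_mul, zero_mul] at hdetK
    exact hdetK rfl
  · calc (gram N v).det • gram N v' = (Matrix.diagonal k * L) * ((gram N v).det • gram N v') := by
          rw [hKL, one_mul]
      _ = Matrix.diagonal k * (((gram N v).adjugate * gram N v) * L * gram N v') := by
          rw [Matrix.adjugate_mul]
          simp [Matrix.mul_assoc]
      _ = Matrix.diagonal k * ((gram N v).adjugate * (gram N v * L * gram N v')) := by
          simp only [Matrix.mul_assoc]
      _ = _ := by rw [h4, Matrix.mul_assoc]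

theorem toBilin'_comm {N : Matrix (Fin 3) (Fin 3) F} (hN : N.IsSymm) (x y : Fin 3 → F) :
    Matrix.toBilin' N x y = Matrix.toBilin' N y x := by
  simp only [Matrix.toBilin'_apply']
  rw [Matrix.dotProduct_mulVec, ← Matrix.mulVec_transpose, hN.eq, dotProduct_comm]

/-- The Gram matrices of two dual triples determine each other. -/
theorem gram_relations {N : Matrix (Fin 3) (Fin 3) F} (hN : N.IsSymm) {v v' : Fin 3 → Fin 3 → F}
    {k : Fin 3 → F} (hk : ∀ i, k i ≠ 0)
    (h : ∀ i j, Matrix.toBilin' N (v i) (v' j) = if i = j then k i else 0) (i : Fin 3) :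
    (gram N v).det * Matrix.toBilin' N (v' i) (v' i) =
      k i ^ 2 * (Matrix.toBilin' N (v (i + 1)) (v (i + 1)) * Matrix.toBilin' N (v (i + 2)) (v (i + 2)) -
        Matrix.toBilin' N (v (i + 1)) (v (i + 2)) ^ 2) ∧
    (gram N v).det * Matrix.toBilin' N (v' (i + 1)) (v' (i + 2)) =
      k (i + 1) * k (i + 2) *
        (Matrix.toBilin' N (v (i + 2)) (v i) * Matrix.toBilin' N (v i) (v (i + 1)) -
          Matrix.toBilin' N (v i) (v i) * Matrix.toBilin' N (v (i + 1)) (v (i + 2))) := by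
  have key := (gram_dual hN hk h).2
  have e : ∀ i j, (gram N v).det * Matrix.toBilin' N (v' i) (v' j) =
      k i * (gram N v).adjugate i j * k j := by
    intro i j
    have := congrFun (congrFun key i) j
    simpa [gram] using this
  have s10 := toBilin'_comm hN (v 1) (v 0)
  have s20 := toBilin'_comm hN (v 2) (v 0)
  have s21 := toBilin'_comm hN (v 2) (v 1)
  constructor
  · rw [e, Matrix.adjugate_fin_three]
    fin_cases i <;> simp [gram, s10, s20, s21] <;> ring
  · rw [e, Matrix.adjugate_fin_three]
    fin_cases i <;> simp [gram, s10, s20, s21] <;> ring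

theorem det_gram_eq {N : Matrix (Fin 3) (Fin 3) F} (hN : N.IsSymm) (v : Fin 3 → Fin 3 → F)
    (i : Fin 3) :
    (gram N v).det = Matrix.toBilin' N (v i) (v i) *
        (Matrix.toBilin' N (v (i + 1)) (v (i + 1)) * Matrix.toBilin' N (v (i + 2)) (v (i + 2))) +
      2 * Matrix.toBilin' N (v (i + 1)) (v (i + 2)) * Matrix.toBilin' N (v (i + 2)) (v i) *
        Matrix.toBilin' N (v i) (v (i + 1)) -
      Matrix.toBilin' N (v i) (v i) * Matrix.toBilin' N (v (i + 1)) (v (i + 2)) ^ 2 -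
      Matrix.toBilin' N (v (i + 1)) (v (i + 1)) * Matrix.toBilin' N (v (i + 2)) (v i) ^ 2 -
      Matrix.toBilin' N (v (i + 2)) (v (i + 2)) * Matrix.toBilin' N (v i) (v (i + 1)) ^ 2 := by
  have s10 := toBilin'_comm hN (v 1) (v 0)
  have s20 := toBilin'_comm hN (v 2) (v 0)
  have s21 := toBilin'_comm hN (v 2) (v 1)
  rw [Matrix.det_fin_three]
  fin_cases i <;> simp [gram, s10, s20, s21] <;> ring

end Gram

end

section

variable {Φ : Conic}

/-! ### Normalised coordinates of a triangle and its polar triangle -/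

/-- Normalised homogeneous coordinates of a triangle and of its polar triangle. -/
structure DualTriple (Φ : Conic) (T T' : Fin 3 → Point) (v v' : Fin 3 → Vec) (k : Fin 3 → ℂ) :
    Prop where
  rep : ∀ i, Rep (T i) (v i)
  rep' : ∀ i, Rep (T' i) (v' i)
  norm : ∀ i, Φ.form (v i) (v i) = 1
  norm' : ∀ i, Φ.form (v' i) (v' i) = 1
  dual : ∀ i j, Φ.form (v i) (v' j) = if i = j then k i else 0
  ne_zero : ∀ i, k i ≠ 0

theorem DualTriple.symm {T T' : Fin 3 → Point} {v v' : Fin 3 → Vec} {k : Fin 3 → ℂ}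
    (D : DualTriple Φ T T' v v' k) : DualTriple Φ T' T v' v k where
  rep := D.rep'
  rep' := D.rep
  norm := D.norm'
  norm' := D.norm
  dual i j := by
    rw [Φ.form_comm, D.dual]
    by_cases h : i = j
    · subst h; simp
    · rw [if_neg h, if_neg (Ne.symm h)]
  ne_zero := D.ne_zero

/-- The same `d`, the Gram determinant, serves all three sides; so one square root of it fixes those
of all `1 - g²` simultaneously. -/
theorem DualTriple.relations {T T' : Fin 3 → Point} {v v' : Fin 3 → Vec} {k : Fin 3 → ℂ}
    (D : DualTriple Φ T T' v v' k) :
    ∃ d : ℂ, d ≠ 0 ∧ ∀ i,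
      d = k i ^ 2 * (1 - Φ.form (v (i + 1)) (v (i + 2)) ^ 2) ∧
      d * Φ.form (v' (i + 1)) (v' (i + 2)) = k (i + 1) * k (i + 2) *
        (Φ.form (v (i + 2)) (v i) * Φ.form (v i) (v (i + 1)) - Φ.form (v (i + 1)) (v (i + 2))) ∧
      d = 1 + 2 * Φ.form (v (i + 1)) (v (i + 2)) * Φ.form (v (i + 2)) (v i) *
          Φ.form (v i) (v (i + 1)) - Φ.form (v (i + 1)) (v (i + 2)) ^ 2 -
        Φ.form (v (i + 2)) (v i) ^ 2 - Φ.form (v i) (v (i + 1)) ^ 2 := by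
  refine ⟨(gram Φ.M v).det, (gram_dual Φ.symm D.ne_zero D.dual).1, fun i => ?_⟩
  have h := gram_relations Φ.symm D.ne_zero D.dual i
  have h' := det_gram_eq Φ.symm v i
  change _ * Φ.form _ _ = _ * (Φ.form _ _ * Φ.form _ _ - Φ.form _ _ ^ 2) ∧ _ * Φ.form _ _ =
    _ * (Φ.form _ _ * Φ.form _ _ - Φ.form _ _ * Φ.form _ _) at h
  change _ = Φ.form _ _ * (Φ.form _ _ * Φ.form _ _) + 2 * Φ.form _ _ * Φ.form _ _ * Φ.form _ _ -
    Φ.form _ _ * Φ.form _ _ ^ 2 - Φ.form _ _ * Φ.form _ _ ^ 2 -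
    Φ.form _ _ * Φ.form _ _ ^ 2 at h'
  simp only [D.norm, D.norm', mul_one, one_mul] at h h'
  exact ⟨h.1, h.2, h'⟩

/-! ### The magic midpoints -/

/-- A magic midpoint on the line joining two complementary midpoints. -/
theorem sign_of_magic_on_comp {a b c a' b' c' : Vec} {ka kb kc gb gc sb sc μ δb δc p q : ℂ}
    (haa : Φ.form a' a = ka) (hab : Φ.form a' b = 0) (hac : Φ.form a' c = 0)
    (hba : Φ.form b' a = 0) (hbb : Φ.form b' b = kb) (hbc : Φ.form b' c = 0)
    (hca : Φ.form c' a = 0) (hcb : Φ.form c' b = 0) (hcc : Φ.form c' c = kc)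
    (hka : ka ≠ 0) (hkb : kb ≠ 0) (hkc : kc ≠ 0) (hgb : gb ≠ 0) (hgc : gc ≠ 0)
    (hsb : sb ^ 2 = 1 - gb ^ 2) (hsb0 : sb ≠ 0) (hsc0 : sc ≠ 0)
    (hδb : δb * δb = 1) (hδc : δc * δc = 1)
    (h : p • (c + (δb / sb) • (c - gb • a)) + q • (a + (δc / sc) • (a - gc • b)) =
      sc⁻¹ • (a - gc • b) + μ • sb⁻¹ • (a - gb • c)) :
    μ * δb = δc := by
  -- Pairing with the dual vectors reads off the coefficients of `a, b, c`.
  have ha := congrArg (Φ.form a') h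
  have hb := congrArg (Φ.form b') h
  have hc := congrArg (Φ.form c') h
  simp only [map_add, map_sub, map_smul, smul_eq_mul, haa, hab, hac, hba, hbb, hbc, hca, hcb, hcc]
    at ha hb hc
  rw [div_eq_mul_inv, div_eq_mul_inv] at ha hb hc
  have eb : sb * sb⁻¹ = 1 := mul_inv_cancel₀ hsb0
  have hic : sc⁻¹ ≠ 0 := inv_ne_zero hsc0
  generalize sb⁻¹ = tb at *
  generalize sc⁻¹ = tc at *
  have h1 : q * δc = 1 :=
    mul_right_cancel₀ (mul_ne_zero (mul_ne_zero hic hgc) hkb) (by linear_combination -hb)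
  have hq : q = δc := by linear_combination δc * h1 - q * hδc
  have h2 : p * (sb + δb) = -(μ * gb) :=
    mul_right_cancel₀ hkc (by linear_combination sb * hc - (p * δb + μ * gb) * kc * eb)
  have h3 : μ = -(p * δb * gb) + q * sb :=
    mul_right_cancel₀ hka (by
      linear_combination -sb * ha + (-(p * δb * gb) - μ) * ka * eb + sb * tc * ka * h1)
  -- Otherwise `sb² = 1`, hence `gb = 0`.
  have hs1 : 1 + δb * sb ≠ 0 := by
    intro h0
    have : gb ^ 2 = 0 := by
      linear_combination hsb + (1 - δb * sb) * h0 + sb ^ 2 * hδb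
    exact hgb (pow_eq_zero_iff two_ne_zero |>.1 this)
  have h4 : (μ * δb - q) * ((1 + δb * sb) * sb) = 0 := by
    linear_combination (1 + δb * sb) * h3 - gb * h2 + μ * hsb +
      (μ * sb ^ 2 - p * sb * gb) * hδb
  have := (mul_eq_zero.1 h4).resolve_right (mul_ne_zero hs1 hsb0)
  linear_combination this + hq

/-- A magic midpoint on the line joining two midpoints. -/
theorem sign_of_magic_on_mid {ga gb gc kb kc d r μ p q : ℂ}
    (hkb : kb ≠ 0) (hkc : kc ≠ 0) (hd : d ≠ 0) (hr : r ^ 2 = d)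
    (hdb : d = kb ^ 2 * (1 - gb ^ 2)) (hdc : d = kc ^ 2 * (1 - gc ^ 2))
    (hdet : d = 1 + 2 * ga * gb * gc - ga ^ 2 - gb ^ 2 - gc ^ 2) (hbc : gb + gc ≠ 0)
    (hμ : μ * μ = 1)
    (ha : p * (gb + gc) = r / kc + μ * (r / kb))
    (hb : p * (1 + ga) + q * kb = μ * ((gc - ga * gb) / (r / kb)))
    (hc : p * (1 + ga) + q * kc = (gb - ga * gc) / (r / kc)) : μ = 1 := by
  have hr0 : r ≠ 0 := by rintro rfl; exact hd (by rw [← hr]; ring)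
  rcases mul_self_eq_one_iff.1 hμ with h | h
  · exact h
  exfalso
  subst h
  set sb := r / kb with hsb
  set sc := r / kc with hsc
  have hsb0 : sb ≠ 0 := div_ne_zero hr0 hkb
  have hsc0 : sc ≠ 0 := div_ne_zero hr0 hkc
  have eb : sb ^ 2 = 1 - gb ^ 2 := by
    rw [hsb, div_pow, hr, hdb]; field_simp
  have ec : sc ^ 2 = 1 - gc ^ 2 := by
    rw [hsc, div_pow, hr, hdc]; field_simp
  have ekb : kb = r / sb := by rw [hsb]; field_simp
  have ekc : kc = r / sc := by rw [hsc]; field_simp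
  rw [ekb] at hb
  rw [ekc] at hc
  clear_value sb sc
  field_simp at hb hc
  -- Under the assumption `μ = -1`, this eliminates `p` and `q` from the three incidence equations.
  have h1 : (1 + ga) * (sb - sc) ^ 2 = (1 - ga) * (gb + gc) ^ 2 := by
    linear_combination (1 + ga) * (sb - sc) * ha - (gb + gc) * (hb - hc)
  have h2 : d = (1 + ga) * (gb * gc + sb * sc - ga) := by
    linear_combination hdet + h1 / 2 - (1 + ga) / 2 * (eb + ec)
  -- A second factorisation of `d`; it shares with the previous one a factor that is nonzero because
  -- `d` is. Cancelling it leaves `1 + gb gc = sb sc`, whose square says `(gb + gc)² = 0`.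
  have h3 : d = (sb * sc - ga + gb * gc) * (sb * sc + ga - gb * gc) := by
    linear_combination hdet - (sb ^ 2) * ec - (1 - gc ^ 2) * eb
  have h4 : gb * gc + sb * sc - ga ≠ 0 := fun h => hd (by rw [h2, h, mul_zero])
  have h5 : 1 + gb * gc = sb * sc := by
    have : (gb * gc + sb * sc - ga) * (1 + gb * gc - sb * sc) = 0 := by
      linear_combination h3 - h2
    have := (mul_eq_zero.1 this).resolve_left h4
    linear_combination this
  have h6 : (gb + gc) ^ 2 = 0 := by
    linear_combination (1 + gb * gc + sb * sc) * h5 + sb ^ 2 * ec + (1 - gc ^ 2) * eb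
  exact hbc (pow_eq_zero_iff two_ne_zero |>.1 h6)

end

section

variable {Φ : Conic}

/-! ### The law of cosines -/

theorem Fin.three_add (i : Fin 3) :
    i + 1 + 1 = i + 2 ∧ i + 1 + 2 = i ∧ i + 2 + 1 = i ∧ i + 2 + 2 = i + 1 ∧
      i ≠ i + 1 ∧ i ≠ i + 2 ∧ i + 1 ≠ i ∧ i + 2 ≠ i ∧ i + 1 ≠ i + 2 ∧ i + 2 ≠ i + 1 := by
  revert i
  decide

theorem form_normalised {a b : Vec} {s : ℂ} (ha : Φ.form a a = 1) (hb : Φ.form b b = 1)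
    (hs : s ^ 2 = 1 - Φ.form a b ^ 2) (hs0 : s ≠ 0) :
    Φ.form (s⁻¹ • (a - Φ.form a b • b)) (s⁻¹ • (a - Φ.form a b • b)) = 1 := by
  set g := Φ.form a b with hg
  simp [ha, hb, Φ.form_comm b a, ← hg]
  field_simp
  linear_combination -hs

/-- The law of cosines in normalised coordinates. -/
theorem DualTriple.law {T T' mid mid' comp m : Fin 3 → Point} {v v' : Fin 3 → Vec}
    {k : Fin 3 → ℂ} (D : DualTriple Φ T T' v v' k)
    (hne : ∀ i j, i ≠ j → T i ≠ T j) (hne' : ∀ i j, i ≠ j → T' i ≠ T' j)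
    (hmid : ∀ i, Rep (mid i) (v (i + 1) + v (i + 2)))
    (hmid' : ∀ i, Rep (mid' i) (v' (i + 1) + v' (i + 2)))
    (hA : ∀ i, Φ.form (v i) (v (i + 1) + v (i + 2)) ≠ 0)
    (hcomp : ∀ i, Φ.IsMidpoint (T (i + 1)) (Φ.conj (side T i) (T (i + 2))) (comp i))
    (hm : ∀ i,
      Φ.IsMidpoint (Φ.conj (side T (i + 2)) (T (i + 1))) (Φ.conj (side T (i + 1)) (T (i + 2))) (m i) ∨
      Φ.IsMidpoint (Φ.conj (side T (i + 1)) (T (i + 2))) (Φ.conj (side T (i + 2)) (T (i + 1))) (m i))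
    (h1 : ∀ i, On (m i) (join (mid i) (mid' i)))
    (h2 : ∀ i, On (m i) (join (comp (i + 1)) (comp (i + 2)))) (i : Fin 3) :
    Φ.cc (T (i + 1)) (T (i + 2)) (mid i) =
      -(Φ.ss (T (i + 2 + 1)) (T (i + 2 + 2)) (comp (i + 2)) *
        Φ.ss (T (i + 1 + 1)) (T (i + 1 + 2)) (comp (i + 1)) *
        Φ.cc (T' (i + 1)) (T' (i + 2)) (mid' i)) -
      Φ.cc (T (i + 2 + 1)) (T (i + 2 + 2)) (mid (i + 2)) *
        Φ.cc (T (i + 1 + 1)) (T (i + 1 + 2)) (mid (i + 1)) := by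
  obtain ⟨d, hd, hrel⟩ := D.relations
  -- The sines are taken as `r / k i` with a common `r`, so that no unknown sign enters the products
  -- `s_b s_c`.
  obtain ⟨r, hr⟩ : ∃ r : ℂ, r ^ 2 = d := by
    obtain ⟨r, hr⟩ := IsAlgClosed.exists_pow_nat_eq d (n := 2) (by norm_num)
    exact ⟨r, hr⟩
  have hr0 : r ≠ 0 := by rintro rfl; exact hd (by rw [← hr]; ring)
  have hcc : ∀ i, Φ.cc (T (i + 1)) (T (i + 2)) (mid i) = -Φ.form (v (i + 1)) (v (i + 2)) := by
    intro i
    have := cc_eq (Φ := Φ) (ε := 1) (D.rep (i + 1)) (D.rep (i + 2))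
      (hne _ _ (Fin.three_add i).2.2.2.2.2.2.2.2.1) (D.norm _) (by simp) (D := mid i)
      (by rw [one_smul]; exact hmid i)
    rw [this, one_mul]
  have hcc' : Φ.cc (T' (i + 1)) (T' (i + 2)) (mid' i) = -Φ.form (v' (i + 1)) (v' (i + 2)) := by
    have := cc_eq (Φ := Φ) (ε := 1) (D.rep' (i + 1)) (D.rep' (i + 2))
      (hne' _ _ (Fin.three_add i).2.2.2.2.2.2.2.2.1) (D.norm' _) (by simp) (D := mid' i)
      (by rw [one_smul]; exact hmid' i)
    rw [this, one_mul]
  have hs : ∀ i, (r / k i) ^ 2 = 1 - Φ.form (v (i + 1)) (v (i + 2)) ^ 2 := by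
    intro i
    have := D.ne_zero i
    rw [div_pow, hr, (hrel i).1]
    field_simp
  have hs0 : ∀ i, r / k i ≠ 0 := fun i => div_ne_zero hr0 (D.ne_zero i)
  have hss := fun i => (hcomp i).exists_sign_conj (D.rep (i + 1)) (D.rep (i + 2))
      (hne _ _ (Fin.three_add i).2.2.2.2.2.2.2.2.1) (D.norm _) (D.norm _) (hs i) (hs0 i)
  choose hg δ hδ hG hssi using hss
  obtain ⟨e11, e12, e21, e22, n01, n02, n10, n20, n12, n21⟩ := Fin.three_add i
  have hrelb := hrel (i + 1)
  have hrelc := hrel (i + 2)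
  have hrel := hrel i
  have hgb := hg (i + 1)
  have hgc := hg (i + 2)
  have hGb := hG (i + 1)
  have hGc := hG (i + 2)
  have hsb := hs (i + 1)
  have hsc := hs (i + 2)
  have hsb0 := hs0 (i + 1)
  have hsc0 := hs0 (i + 2)
  have hkb := D.ne_zero (i + 1)
  have hkc := D.ne_zero (i + 2)
  rw [hcc, hcc, hcc, hssi, hssi, hcc']
  have h2 := h2 i
  have hmi := hm i
  simp only [side, e11, e12, e21, e22] at *
  -- The only sign that the Gram identity leaves open is `δ_b δ_c`.
  have key : δ (i + 1) = δ (i + 2) := by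
    have hP := (D.rep (i + 1)).conj ((D.rep i).linearIndependent (D.rep (i + 1)) (hne _ _ n01))
      (by rw [D.norm]; exact one_ne_zero)
    have hQ := (D.rep (i + 2)).conj_left ((D.rep (i + 2)).linearIndependent (D.rep i) (hne _ _ n20))
      (by rw [D.norm]; exact one_ne_zero)
    rw [D.norm, one_smul, ← (D.rep i).join_eq (D.rep (i + 1))] at hP
    rw [D.norm, one_smul, ← (D.rep (i + 2)).join_eq (D.rep i)] at hQ
    have hP := hP.smul (inv_ne_zero hsc0)
    have hQ := hQ.smul (inv_ne_zero hsb0)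
    have nP := form_normalised (D.norm i) (D.norm (i + 1)) hsc hsc0
    have nQ := form_normalised (D.norm i) (D.norm (i + 2)) (by rw [Φ.form_comm]; exact hsb) hsb0
    rw [Φ.form_comm (v i) (v (i + 2))] at nQ
    obtain ⟨μ, hμ, rm⟩ : ∃ μ : ℂ, μ * μ = 1 ∧ Rep (m i)
        ((r / k (i + 2))⁻¹ • (v i - Φ.form (v i) (v (i + 1)) • v (i + 1)) + μ •
          (r / k (i + 1))⁻¹ • (v i - Φ.form (v (i + 2)) (v i) • v (i + 2))) := by
      -- Interchanging the endpoints only rescales the coordinates by `μ`, since `μ² = 1`. The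
      -- second order is the one that occurs for the polar triangle.
      rcases hmi with h | h
      · exact h.exists_sign hP hQ nP nQ
      · obtain ⟨μ, hμ, rm⟩ := h.exists_sign hQ hP nQ nP
        refine ⟨μ, hμ, ?_⟩
        have := rm.smul (left_ne_zero_of_mul_eq_one hμ)
        rwa [smul_add, smul_smul μ μ, hμ, one_smul, add_comm] at this
    rw [hGb.join_eq hGc, rm.on_iff, Submodule.mem_span_pair] at h2
    obtain ⟨p, q, h2⟩ := h2
    have d0 := fun j => (Φ.form_comm (v' i) (v j)).trans (D.dual j i)
    have d1 := fun j => (Φ.form_comm (v' (i + 1)) (v j)).trans (D.dual j (i + 1))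
    have d2 := fun j => (Φ.form_comm (v' (i + 2)) (v j)).trans (D.dual j (i + 2))
    have hμδ : μ * δ (i + 1) = δ (i + 2) :=
      sign_of_magic_on_comp (Φ := Φ) (a' := v' i) (b' := v' (i + 1)) (c' := v' (i + 2))
        (by rw [d0, if_pos rfl]) (by rw [d0, if_neg n10]) (by rw [d0, if_neg n20])
        (by rw [d1, if_neg n01]) (by rw [d1, if_pos rfl]) (by rw [d1, if_neg n21])
        (by rw [d2, if_neg n02]) (by rw [d2, if_neg n12]) (by rw [d2, if_pos rfl])
        (D.ne_zero _) (D.ne_zero _) (D.ne_zero _) hgb hgc hsb hsb0 hsc0 (hδ _) (hδ _) h2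
    have h1 := h1 i
    rw [(hmid i).join_eq (hmid' i), rm.on_iff, Submodule.mem_span_pair] at h1
    obtain ⟨p, q, h1⟩ := h1
    have ha := congrArg (Φ.form (v i)) h1
    have hb := congrArg (Φ.form (v (i + 1))) h1
    have hc := congrArg (Φ.form (v (i + 2))) h1
    have hA := hA i
    have c20 := Φ.form_comm (v i) (v (i + 2))
    have c10 := Φ.form_comm (v (i + 1)) (v i)
    have c21 := Φ.form_comm (v (i + 2)) (v (i + 1))
    simp only [map_add, map_sub, map_smul, smul_eq_mul, D.norm, D.dual, if_neg n01, if_neg n02,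
      if_neg n12, if_neg n21, if_true, c20, c10, c21] at ha hb hc hA
    -- The incidence with `DD'`, paired with the three vertices.
    have hμ1 : μ = 1 := by
      refine sign_of_magic_on_mid (ga := Φ.form (v (i + 1)) (v (i + 2)))
        (gb := Φ.form (v (i + 2)) (v i)) (gc := Φ.form (v i) (v (i + 1))) (p := p) (q := q)
        hkb hkc hd hr ?_ ?_ hrel.2.2 ?_ hμ ?_ ?_ ?_
      · simpa only [e11, e12] using hrelb.1
      · simpa only [e21, e22] using hrelc.1
      · rwa [add_comm]
      · generalize r / k (i + 1) = sb at *
        generalize r / k (i + 2) = sc at *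
        field_simp at ha
        apply mul_right_cancel₀ (mul_ne_zero hsc0 hsb0)
        linear_combination ha - sb * hsc - sc * μ * hsb
      · rw [div_eq_mul_inv]
        linear_combination hb
      · rw [div_eq_mul_inv]
        linear_combination hc
    rw [hμ1, one_mul] at hμδ
    exact hμδ
  rw [key]
  have h3 : r / k (i + 2) * (r / k (i + 1)) * Φ.form (v' (i + 1)) (v' (i + 2)) =
      Φ.form (v (i + 2)) (v i) * Φ.form (v i) (v (i + 1)) - Φ.form (v (i + 1)) (v (i + 2)) := by
    field_simp
    rw [hr]
    linear_combination hrel.2.1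
  linear_combination -h3 - r / k (i + 2) * (r / k (i + 1)) *
    Φ.form (v' (i + 1)) (v' (i + 2)) * hδ (i + 2)

end

/-! ### Sign choices for the vertices and the general law of cosines -/

section

variable {Φ : Conic}

theorem exists_normal_rep {P : Point} (h : ¬ Φ.Contains P) : ∃ v, Rep P v ∧ Φ.form v v = 1 := by
  obtain ⟨v, hv⟩ := exists_rep P
  rw [hv.contains_iff] at h
  obtain ⟨c, hc⟩ := IsAlgClosed.exists_pow_nat_eq (Φ.form v v) (n := 2) (by norm_num)
  have hc0 : c ≠ 0 := by rintro rfl; exact h (by rw [← hc]; ring)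
  refine ⟨c⁻¹ • v, hv.smul (inv_ne_zero hc0), ?_⟩
  simp only [map_smul, LinearMap.smul_apply, smul_eq_mul, ← hc]
  field_simp

/-- Coordinates in which the preferred midpoints are the sums of the endpoints. -/
theorem exists_rep_midpoints {T mid : Fin 3 → Point} (hT : ∀ i, ¬ Φ.Contains (T i))
    (hmid : ∀ i, Φ.IsMidpoint (T (i + 1)) (T (i + 2)) (mid i))
    (hind : Projectivization.Independent mid) :
    ∃ v : Fin 3 → Vec, (∀ i, Rep (T i) (v i)) ∧ (∀ i, Φ.form (v i) (v i) = 1) ∧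
      ∀ i, Rep (mid i) (v (i + 1) + v (i + 2)) := by
  choose w hw hw1 using fun i => exists_normal_rep (hT i)
  choose ε hε hmr using fun i =>
    (hmid i).exists_sign (hw (i + 1)) (hw (i + 2)) (hw1 (i + 1)) (hw1 (i + 2))
  -- If the product were `-1`, then `mid 0 - ε₀ mid 1 + ε₀ ε₁ mid 2 = (1 + ε₀ ε₁ ε₂) w₁` would
  -- vanish and the midpoints would be collinear.
  have hprod : ε 0 * ε 1 * ε 2 = 1 := by
    have hsq : (ε 0 * ε 1 * ε 2) * (ε 0 * ε 1 * ε 2) = 1 := by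
      linear_combination ε 1 ^ 2 * ε 2 ^ 2 * hε 0 + ε 2 ^ 2 * hε 1 + hε 2
    refine (mul_self_eq_one_iff.1 hsq).resolve_right fun h => ?_
    refine not_independent_of_combination hmr one_ne_zero (b := -ε 0) (c := ε 0 * ε 1) ?_ hind
    have : (1 + ε 0 * ε 1 * ε 2) • w 1 = 0 := by rw [h]; simp
    change (1 : ℂ) • (w 1 + ε 0 • w 2) + -ε 0 • (w 2 + ε 1 • w 0) +
      (ε 0 * ε 1) • (w 0 + ε 2 • w 1) = 0
    linear_combination (norm := module) this
  -- Vertex `0` is kept; the signs of the other two are forced by the sides through it, and the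
  -- product condition makes the opposite side fit.
  let τ : Fin 3 → ℂ := ![1, ε 2, ε 1]
  have hτ : ∀ i, τ i * τ i = 1 := by
    intro i; fin_cases i <;> simp [τ, hε]
  have hτε : ∀ i, τ (i + 1) * ε i = τ (i + 2) := by
    intro i
    fin_cases i
    · change ε 2 * ε 0 = ε 1
      linear_combination ε 1 * hprod - ε 0 * ε 2 * hε 1
    · change ε 1 * ε 1 = 1
      exact hε 1
    · change 1 * ε 2 = ε 2
      exact one_mul _
  refine ⟨fun i => τ i • w i, fun i => (hw i).smul (left_ne_zero_of_mul_eq_one (hτ i)), fun i => ?_,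
    fun i => ?_⟩
  · simp [hw1, hτ]
  · have := (hmr i).smul (left_ne_zero_of_mul_eq_one (hτ (i + 1)))
    rwa [smul_add, smul_smul, hτε] at this

theorem eq_zero_of_form_triple {v : Fin 3 → Vec} (hv : LinearIndependent ℂ v) {x : Vec}
    (h : ∀ i, Φ.form (v i) x = 0) : x = 0 := by
  apply Φ.eq_zero_of_form
  intro y
  have hy : y ∈ Submodule.span ℂ (Set.range v) := by
    rw [hv.span_eq_top_of_card_eq_finrank (by simp)]
    trivial
  rw [Φ.form_comm]
  induction hy using Submodule.span_induction with
  | mem z hz => obtain ⟨i, rfl⟩ := hz; exact h i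
  | zero => simp
  | add a b _ _ ha hb => simp [ha, hb]
  | smul c a _ ha => simp [ha]

theorem Conic.GeneralPosition.ne {T : Fin 3 → Point} (h : Φ.GeneralPosition T) {i j : Fin 3}
    (hij : i ≠ j) : T i ≠ T j := by
  intro e
  exact hij ((Projectivization.independent_iff.1 h.noncollinear).injective
    (congrArg Projectivization.rep e))

theorem polar_polarTriangle {T : Fin 3 → Point} {i : Fin 3} (h : T (i + 1) ≠ T (i + 2)) :
    Φ.polar (Φ.polarTriangle T i) = side T i := by
  obtain ⟨v, hv⟩ := exists_rep (T (i + 1))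
  obtain ⟨w, hw⟩ := exists_rep (T (i + 2))
  obtain ⟨P, n, hP, -, -, hp⟩ := Φ.exists_polar_eq_span (hv.linearIndependent hw h)
  rw [Conic.polarTriangle, side, hv.join_eq hw, ← hp, Φ.pole_polar]

theorem form_polarTriangle {T : Fin 3 → Point} (hT : ∀ i j, i ≠ j → T i ≠ T j) {v v' : Fin 3 → Vec}
    (hv : ∀ i, Rep (T i) (v i)) (hv' : ∀ i, Rep (Φ.polarTriangle T i) (v' i)) {i j : Fin 3}
    (hij : i ≠ j) : Φ.form (v i) (v' j) = 0 := by
  rw [Φ.form_comm, ← (hv' j).mem_polar_iff, polar_polarTriangle, ← (hv i).on_iff, side]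
  · have : i = j + 1 ∨ i = j + 2 := by revert i j; decide
    rcases this with rfl | rfl
    · exact le_sup_left
    · exact le_sup_right
  · exact hT _ _ (Fin.three_add j).2.2.2.2.2.2.2.2.1

theorem Conic.GeneralPosition.dualTriple {T : Fin 3 → Point} (h : Φ.GeneralPosition T)
    {v v' : Fin 3 → Vec} (hv : ∀ i, Rep (T i) (v i))
    (hv' : ∀ i, Rep (Φ.polarTriangle T i) (v' i)) (hn : ∀ i, Φ.form (v i) (v i) = 1)
    (hn' : ∀ i, Φ.form (v' i) (v' i) = 1) :
    DualTriple Φ T (Φ.polarTriangle T) v v' (fun i => Φ.form (v i) (v' i)) where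
  rep := hv
  rep' := hv'
  norm := hn
  norm' := hn'
  dual i j := by
    by_cases hij : i = j
    · subst hij; simp
    · rw [if_neg hij, form_polarTriangle (fun _ _ => h.ne) hv hv' hij]
  ne_zero i h0 := by
    have hind := (Rep.independent_iff hv).1 h.noncollinear
    refine (hv' i).1 (eq_zero_of_form_triple (Φ := Φ) hind fun j => ?_)
    by_cases hij : j = i
    · subst hij; exact h0
    · exact form_polarTriangle (fun _ _ => h.ne) hv hv' hij

variable {T T' : Fin 3 → Point} {v v' : Fin 3 → Vec} {k : Fin 3 → ℂ}

theorem DualTriple.ne (D : DualTriple Φ T T' v v' k) (i j : Fin 3) (hij : i ≠ j) : T i ≠ T j := by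
  intro e
  obtain ⟨c, hc, h⟩ := (D.rep i).exists_smul (e ▸ D.rep j)
  have := D.dual j i
  rw [h, if_neg (Ne.symm hij)] at this
  simp [D.dual, hc, D.ne_zero] at this

theorem DualTriple.side_eq (D : DualTriple Φ T T' v v' k) (i : Fin 3) :
    side T i = Φ.polar (T' i) := by
  obtain ⟨-, -, -, -, -, -, n10, n20, n12, -⟩ := Fin.three_add i
  rw [side, (D.rep _).join_eq (D.rep _), (D.rep' i).polar_eq_span
    ((D.rep _).linearIndependent (D.rep _) (D.ne _ _ n12))]
  · rw [Φ.form_comm, D.dual, if_neg n10]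
  · rw [Φ.form_comm, D.dual, if_neg n20]

/-- The points `B_c` and `C'_{b'}` coincide. -/
theorem DualTriple.conj_eq (D : DualTriple Φ T T' v v' k) (i : Fin 3) :
    Φ.conj (side T (i + 2)) (T (i + 1)) = Φ.conj (side T' (i + 1)) (T' (i + 2)) := by
  obtain ⟨-, -, -, -, -, -, -, -, n12, n21⟩ := Fin.three_add i
  have h0 : Φ.form (v (i + 1)) (v' (i + 2)) = 0 := by rw [D.dual, if_neg n12]
  -- Both points are the intersection of the polars of `T (i + 1)` and `T' (i + 2)`.
  obtain ⟨x, hx, h1, h2⟩ := Φ.exists_orthogonal (v (i + 1)) (v' (i + 2))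
  obtain ⟨X, hX⟩ := exists_point hx
  rw [Φ.form_comm] at h1 h2
  have hind : LinearIndependent ℂ ![v (i + 1), v' (i + 2)] :=
    form_ne_of_independent (by rw [D.norm]; exact one_ne_zero) (D.rep' _).1 h0
  rw [Conic.conj, Conic.conj, D.side_eq, D.symm.side_eq,
    meet_polar (D.rep' _) (D.rep _) hX (LinearIndependent.pair_symm_iff.1 hind) h2 h1,
    meet_polar (D.rep _) (D.rep' _) hX hind h1 h2]

/-- A midpoint of `BC` conjugate to `A` would lie on both `a` and `a' = ρ(A)`, hence be `A₀`. This
is the condition `g_b + g_c ≠ 0`. -/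
theorem DualTriple.form_mid_ne (D : DualTriple Φ T T' v v' k) {i : Fin 3} (hne : T i ≠ T' i)
    {M : Point} (hM : Rep M (v (i + 1) + v (i + 2))) (h : M ≠ meet (side T i) (side T' i)) :
    Φ.form (v i) (v (i + 1) + v (i + 2)) ≠ 0 := by
  obtain ⟨-, -, -, -, n01, n02, n10, n20, -, -⟩ := Fin.three_add i
  intro h0
  apply h
  rw [D.side_eq, D.symm.side_eq]
  refine (meet_polar (D.rep' i) (D.rep i) hM
    ((D.rep' i).linearIndependent (D.rep i) (Ne.symm hne)) ?_ h0).symm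
  rw [Φ.form_comm]
  simp [D.dual, n10, n20]

theorem meet_comm (p q : Line) : meet p q = meet q p := by
  rw [meet, meet, inf_comm]

/-- The projective law of cosines. -/
theorem law_of_cosines {T : Fin 3 → Point} (o : Φ.Orientation T)
    (o' : Φ.Orientation (Φ.polarTriangle T)) (hT : Φ.GeneralPosition T)
    (h : Φ.CoherentlyOriented T o o') (i : Fin 3) :
    o.cc i = -(o.ss (i + 2) * o.ss (i + 1) * o'.cc i) - o.cc (i + 2) * o.cc (i + 1) ∧
    o'.cc i = -(o'.ss (i + 2) * o'.ss (i + 1) * o.cc i) - o'.cc (i + 2) * o'.cc (i + 1) := by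
  obtain ⟨v, hv, hn, hm⟩ := exists_rep_midpoints hT.vertex_off o.isMid h.mid_noncollinear
  obtain ⟨v', hv', hn', hm'⟩ := exists_rep_midpoints hT.polar_vertex_off o'.isMid h.mid'_noncollinear
  have D := hT.dualTriple hv hv' hn hn'
  obtain ⟨m, -, hmag⟩ := h.magic
  have hne := D.ne
  have hne' := D.symm.ne
  constructor
  · exact D.law hne hne' hm hm'
      (fun i => D.form_mid_ne (hT.vertices_ne i i) (hm i) (h.mid_ne i)) o.isComp
      (fun i => Or.inl (hmag i).1) (fun i => (hmag i).2.1) (fun i => (hmag i).2.2.1) i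
  -- The dual law applies the same lemma to the polar triangle; since `B_c = C'_{b'}`, the magic
  -- segments coincide up to the order of their endpoints.
  · refine D.symm.law hne' hne hm' hm
      (fun i => D.symm.form_mid_ne (hT.vertices_ne i i).symm (hm' i) ?_) o'.isComp
      (fun i => Or.inr ?_) (fun i => ?_) (fun i => (hmag i).2.2.2) i
    · rw [meet_comm]; exact h.mid'_ne i
    · rw [← D.conj_eq, D.symm.conj_eq]; exact (hmag i).1
    · have := (hmag i).2.1
      rwa [join, sup_comm] at this

end

section

variable {Φ : Conic}

/-! ### The squares of the trigonometric ratios -/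

theorem exists_normal_smul {x : Vec} (hx : Φ.form x x ≠ 0) :
    ∃ p : ℂ, p ≠ 0 ∧ p ^ 2 = Φ.form x x ∧ Φ.form (p⁻¹ • x) (p⁻¹ • x) = 1 := by
  obtain ⟨c, hc⟩ := IsAlgClosed.exists_pow_nat_eq (Φ.form x x) (n := 2) (by norm_num)
  have hc0 : c ≠ 0 := by rintro rfl; exact hx (by rw [← hc]; ring)
  refine ⟨c, hc0, hc, ?_⟩
  simp only [map_smul, LinearMap.smul_apply, smul_eq_mul, ← hc]
  field_simp

/-- Squaring removes the choice of midpoint, so arbitrary (in particular real) coordinates can be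
used. -/
theorem cc_sq {X Y D : Point} {x y : Vec} (hX : Rep X x) (hY : Rep Y y)
    (hx : Φ.form x x ≠ 0) (hy : Φ.form y y ≠ 0) (hD : Φ.IsMidpoint X Y D) :
    Φ.cc X Y D ^ 2 * (Φ.form x x * Φ.form y y) = Φ.form x y ^ 2 := by
  obtain ⟨p, hp, hpx, hx1⟩ := exists_normal_smul hx
  obtain ⟨q, hq, hqy, hy1⟩ := exists_normal_smul hy
  have hX' := hX.smul (inv_ne_zero hp)
  have hY' := hY.smul (inv_ne_zero hq)
  obtain ⟨ε, hε, hr⟩ := hD.exists_sign hX' hY' hx1 hy1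
  rw [cc_eq hX' hY' hD.1 hy1 hε hr, ← hpx, ← hqy]
  simp only [map_smul, LinearMap.smul_apply, smul_eq_mul]
  field_simp
  linear_combination Φ.form x y ^ 2 * hε

theorem ss_sq {X Y G : Point} {x y : Vec} (hX : Rep X x) (hY : Rep Y y) (hne : X ≠ Y)
    (hx : Φ.form x x ≠ 0) (hy : Φ.form y y ≠ 0)
    (hd : Φ.form x x * Φ.form y y - Φ.form x y ^ 2 ≠ 0)
    (hG : Φ.IsMidpoint X (Φ.conj (join X Y) Y) G) :
    Φ.ss X Y G ^ 2 * (Φ.form x x * Φ.form y y) = Φ.form x x * Φ.form y y - Φ.form x y ^ 2 := by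
  obtain ⟨p, hp, hpx, hx1⟩ := exists_normal_smul hx
  obtain ⟨q, hq, hqy, hy1⟩ := exists_normal_smul hy
  have hX' := hX.smul (inv_ne_zero hp)
  have hY' := hY.smul (inv_ne_zero hq)
  have hg : Φ.form (p⁻¹ • x) (q⁻¹ • y) = Φ.form x y / (p * q) := by
    simp only [map_smul, LinearMap.smul_apply, smul_eq_mul]
    field_simp
  obtain ⟨s, hs⟩ := IsAlgClosed.exists_pow_nat_eq (1 - Φ.form (p⁻¹ • x) (q⁻¹ • y) ^ 2) (n := 2)
    (by norm_num)
  have hs' : s ^ 2 * (p ^ 2 * q ^ 2) = p ^ 2 * q ^ 2 - Φ.form x y ^ 2 := by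
    rw [hs, hg]
    field_simp
  have hs0 : s ≠ 0 := by
    rintro rfl
    apply hd
    rw [← hpx, ← hqy, ← hs']
    ring
  obtain ⟨-, δ, hδ, -, h⟩ := hG.exists_sign_conj hX' hY' hne hx1 hy1 hs hs0
  rw [h, ← hpx, ← hqy]
  linear_combination hs' + s ^ 2 * p ^ 2 * q ^ 2 * hδ

/-! ### Intersections of a line with the conic -/

/-- The cross ratios of the endpoints of a segment, or of the points conjugate to them, with the
intersections of the segment with the conic. -/
theorem exists_cuts {X Y : Point} {x y : Vec} (hX : Rep X x) (hY : Rep Y y)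
    (hxy : LinearIndependent ℂ ![x, y]) {e f g w : ℂ} (hx : Φ.form x x = e) (hy : Φ.form y y = f)
    (hg : Φ.form x y = g) (he : e ≠ 0) (hf : f ≠ 0) (hw : w ^ 2 = g ^ 2 - e * f) (hw0 : w ≠ 0) :
    ∃ U V : Point, Rep U (y + ((w - g) / e) • x) ∧ Rep V (y + ((-w - g) / e) • x) ∧
      Φ.Cuts (join X Y) U V ∧
      crossRatio U V X Y = (g + w) / (g - w) ∧
      crossRatio U V (Φ.conj (join X Y) X) (Φ.conj (join X Y) Y) = (g + w) / (g - w) ∧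
      crossRatio U V X (Φ.conj (join X Y) Y) = -((g + w) / (g - w)) ∧
      crossRatio U V (Φ.conj (join X Y) X) Y = -((g + w) / (g - w)) := by
  have hxy' := LinearIndependent.pair_iff.1 hxy
  have hX' := hX.conj_left hxy (by rwa [hx])
  have hY' := hY.conj hxy (by rwa [hy])
  rw [hX.join_eq hY]
  rw [hx, hg] at hX'
  rw [hy, hg] at hY'
  set X' := Φ.conj (Submodule.span ℂ {x, y}) X
  set Y' := Φ.conj (Submodule.span ℂ {x, y}) Y
  -- The coefficients `(±w - g)/e` are the roots of `e t² + 2 g t + f`, the norm of `y + t x`.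
  set u := y + ((w - g) / e) • x with hu
  set v := y + ((-w - g) / e) • x with hv
  have huv : LinearIndependent ℂ ![u, v] := by
    rw [LinearIndependent.pair_iff]
    intro s t hst
    obtain ⟨h1, h2⟩ := hxy' (s * ((w - g) / e) + t * ((-w - g) / e)) (s + t) (by
      rw [← hst, hu, hv]; module)
    have ht : t = -s := by linear_combination h2
    subst ht
    field_simp at h1
    have hs : s = 0 := by
      have : s * w = 0 := by linear_combination h1 / 2
      exact (mul_eq_zero.1 this).resolve_right hw0
    simp [hs]
  have hu0 : u ≠ 0 := huv.ne_zero 0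
  have hv0 : v ≠ 0 := huv.ne_zero 1
  obtain ⟨U, hU⟩ := exists_point hu0
  obtain ⟨V, hV⟩ := exists_point hv0
  have hmem : ∀ c : ℂ, y + c • x ∈ Submodule.span ℂ {x, y} := fun c =>
    Submodule.mem_span_pair.2 ⟨c, 1, by module⟩
  -- In the basis of isotropic vectors `u, v`, passing to the conjugate point changes the sign of
  -- one coordinate. Hence one conjugation negates the cross ratio and two preserve it.
  have rX : Rep X ((1 : ℂ) • u + (-1 : ℂ) • v) := by
    have : (1 : ℂ) • u + (-1 : ℂ) • v = (2 * w / e) • x := by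
      rw [hu, hv]
      match_scalars
      · ring
      · field_simp; ring
    rw [this]
    exact hX.smul (by simp [hw0, he])
  have rY : Rep Y ((w + g) • u + (w - g) • v) := by
    have : (w + g) • u + (w - g) • v = (2 * w) • y := by
      rw [hu, hv]
      match_scalars
      · ring
      · field_simp; ring
    rw [this]
    exact hY.smul (by simp [hw0])
  have rX' : Rep X' ((1 : ℂ) • u + (1 : ℂ) • v) := by
    have : (1 : ℂ) • u + (1 : ℂ) • v = (2 / e) • (e • y - g • x) := by
      rw [hu, hv]
      match_scalars
      · field_simp; ring
      · field_simp; ring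
    rw [this]
    exact hX'.smul (by simp [he])
  have rY' : Rep Y' ((w + g) • u + (-(w - g)) • v) := by
    have : (w + g) • u + (-(w - g)) • v = (-2 : ℂ) • (f • x - g • y) := by
      rw [hu, hv]
      match_scalars
      · ring
      · field_simp; linear_combination 2 * hw
    rw [this]
    exact hY'.smul (by norm_num)
  refine ⟨U, V, hU, hV, ⟨hU.ne hV huv, (hU.on_iff _).2 (hmem _), (hV.on_iff _).2 (hmem _),
    hU.contains_iff.2 ?_, hV.contains_iff.2 ?_⟩, ?_, ?_, ?_, ?_⟩
  · rw [hu, ← one_smul ℂ y, Φ.form_combination, hx, hy, Φ.form_comm, hg]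
    field_simp
    linear_combination hw
  · rw [hv, ← one_smul ℂ y, Φ.form_combination, hx, hy, Φ.form_comm, hg]
    field_simp
    linear_combination hw
  · rw [crossRatio_eq hU hV huv rX rY, ← neg_div_neg_eq]
    congr 1 <;> ring
  · rw [crossRatio_eq hU hV huv rX' rY']
    congr 1 <;> ring
  · rw [crossRatio_eq hU hV huv rX rY', ← div_neg, ← neg_div_neg_eq]
    congr 1 <;> ring
  · rw [crossRatio_eq hU hV huv rX' rY, ← div_neg]
    congr 1 <;> ring

end

section

variable {Φ : Conic}

/-! ### Real conics and real lines -/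

/-- A real vector as a complex vector. -/
def complexify (x : Fin 3 → ℝ) : Vec := fun i => (x i : ℂ)

theorem complexify_combination (a b : ℝ) (x y : Fin 3 → ℝ) :
    complexify (a • x + b • y) = (a : ℂ) • complexify x + (b : ℂ) • complexify y := by
  funext i
  simp [complexify]

theorem complexify_ne_zero {x : Fin 3 → ℝ} : complexify x ≠ 0 ↔ x ≠ 0 := by
  rw [not_iff_not]
  constructor
  · intro h
    funext i
    have := congrFun h i
    simpa [complexify] using this
  · rintro rfl
    funext i
    simp [complexify]

theorem star_complexify (x : Fin 3 → ℝ) : star (complexify x) = complexify x := by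
  funext i
  simp [complexify]

theorem isRealPoint_iff {P : Point} : IsRealPoint P ↔ ∃ x, Rep P (complexify x) := by
  constructor
  · rintro ⟨x, h, rfl⟩
    exact ⟨x, rep_mk h⟩
  · rintro ⟨x, h⟩
    exact ⟨x, h.1, h.eq_mk⟩

/-- `N` is the matrix of a real equation of the conic, normalised to be of negative determinant. -/
structure RealEquation (Φ : Conic) (N : Matrix (Fin 3) (Fin 3) ℝ) (κ : ℂ) : Prop where
  symm : N.IsSymm
  det_neg : N.det < 0
  ne_zero : κ ≠ 0
  form_eq : ∀ x y, Φ.form (complexify x) (complexify y) = κ * (Matrix.toBilin' N x y : ℝ)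

/-- In odd dimension a change of sign of the equation changes the sign of the determinant, so a
negative one can be arranged. -/
theorem Conic.HasRealEquation.exists_realEquation (h : Φ.HasRealEquation) :
    ∃ N κ, RealEquation Φ N κ := by
  obtain ⟨c, hc, hr⟩ := h
  have key : ∀ s : ℝ, s * s = 1 → ∀ N : Matrix (Fin 3) (Fin 3) ℝ,
      (∀ i j, N i j = s * (c * Φ.M i j).re) → N.det < 0 → ∃ N κ, RealEquation Φ N κ := by
    intro s hs N hN hdet
    have hs' : (s : ℂ) * s = 1 := by exact_mod_cast hs
    have hs0 : (s : ℂ) ≠ 0 := left_ne_zero_of_mul_eq_one hs'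
    have hM : ∀ i j, Φ.M i j = s * c⁻¹ * (N i j : ℝ) := by
      intro i j
      have : ((c * Φ.M i j).re : ℂ) = c * Φ.M i j := by
        apply Complex.ext
        · simp
        · rw [Complex.ofReal_im, hr]
      rw [hN, Complex.ofReal_mul, this]
      field_simp
      linear_combination -Φ.M i j * hs'
    refine ⟨N, s * c⁻¹, ?_, hdet, mul_ne_zero hs0 (inv_ne_zero hc), ?_⟩
    · ext i j
      rw [Matrix.transpose_apply, hN, hN, Φ.symm.apply]
    · intro x y
      simp only [Conic.form, Matrix.toBilin'_apply, complexify, hM]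
      push_cast
      rw [Finset.mul_sum]
      refine Finset.sum_congr rfl fun i _ => ?_
      rw [Finset.mul_sum]
      refine Finset.sum_congr rfl fun j _ => ?_
      ring
  set N : Matrix (Fin 3) (Fin 3) ℝ := Matrix.of fun i j => (c * Φ.M i j).re with hN
  have hdet : N.det ≠ 0 := by
    intro h0
    have h1 : (N.map (algebraMap ℝ ℂ)) = c • Φ.M := by
      ext i j
      apply Complex.ext
      · simp [hN]
      · simpa [hN] using (hr i j).symm
    have h2 : (N.map (algebraMap ℝ ℂ)).det = 0 := by
      have := (algebraMap ℝ ℂ).map_det N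
      rw [h0, map_zero] at this
      exact this.symm
    rw [h1, Matrix.det_smul] at h2
    exact mul_ne_zero (pow_ne_zero _ hc) Φ.nondeg h2
  rcases lt_or_gt_of_ne hdet with h | h
  · exact key 1 (by norm_num) N (fun i j => by simp [hN]) h
  · refine key (-1) (by norm_num) (-N) (fun i j => by simp [hN]) ?_
    rw [Matrix.det_neg, Fintype.card_fin]
    linarith

variable {N : Matrix (Fin 3) (Fin 3) ℝ} {κ : ℂ}

theorem RealEquation.comm (R : RealEquation Φ N κ) (x y : Fin 3 → ℝ) :
    Matrix.toBilin' N x y = Matrix.toBilin' N y x := toBilin'_comm R.symm x y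

theorem RealEquation.form_eq_zero (R : RealEquation Φ N κ) {x y : Fin 3 → ℝ} :
    Φ.form (complexify x) (complexify y) = 0 ↔ Matrix.toBilin' N x y = 0 := by
  rw [R.form_eq]
  simp [R.ne_zero]

theorem RealEquation.combination (R : RealEquation Φ N κ) (x y : Fin 3 → ℝ) (a b c d : ℝ) :
    Matrix.toBilin' N (a • x + b • y) (c • x + d • y) =
      a * c * Matrix.toBilin' N x x + (a * d + b * c) * Matrix.toBilin' N x y +
        b * d * Matrix.toBilin' N y y := by
  simp only [map_add, map_smul, LinearMap.add_apply, LinearMap.smul_apply, smul_eq_mul,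
    R.comm y x]
  ring

/-- Complex conjugation fixes the vectors, hence by independence also the coefficients. -/
theorem real_combination {x y r : Fin 3 → ℝ}
    (h : LinearIndependent ℂ ![complexify x, complexify y])
    (hr : complexify r ∈ Submodule.span ℂ {complexify x, complexify y}) :
    ∃ a b : ℝ, r = a • x + b • y := by
  obtain ⟨a, b, hab⟩ := Submodule.mem_span_pair.1 hr
  have h1 := congrArg star hab
  simp only [star_add, star_smul, star_complexify] at h1
  obtain ⟨ha, hb⟩ := LinearIndependent.pair_iff.1 h (star a - a) (star b - b) (by
    rw [sub_smul, sub_smul]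
    linear_combination (norm := module) h1 - hab)
  obtain ⟨a', rfl⟩ := Complex.conj_eq_iff_real.1 (sub_eq_zero.1 ha)
  obtain ⟨b', rfl⟩ := Complex.conj_eq_iff_real.1 (sub_eq_zero.1 hb)
  refine ⟨a', b', ?_⟩
  rw [← complexify_combination] at hab
  funext i
  have := congrFun hab i
  simp only [complexify] at this
  exact_mod_cast this.symm

variable {X Y : Point} {x y : Fin 3 → ℝ}

theorem RealEquation.exteriorLine (R : RealEquation Φ N κ) (hX : Rep X (complexify x))
    (hY : Rep Y (complexify y)) (hne : X ≠ Y)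
    (hd : 0 < Matrix.toBilin' N x x * Matrix.toBilin' N y y - Matrix.toBilin' N x y ^ 2) :
    Φ.ExteriorLine (join X Y) := by
  intro P hP hon hc
  have hxy := hX.linearIndependent hY hne
  obtain ⟨r, hr⟩ := isRealPoint_iff.1 hP
  rw [hX.join_eq hY, hr.on_iff] at hon
  obtain ⟨a, b, rfl⟩ := real_combination hxy hon
  have h0 := R.form_eq_zero.1 (hr.contains_iff.1 hc)
  rw [R.combination] at h0
  set e := Matrix.toBilin' N x x
  set f := Matrix.toBilin' N y y
  set g := Matrix.toBilin' N x y
  have h1 : (a * e + b * g) ^ 2 + b ^ 2 * (e * f - g ^ 2) = 0 := by linear_combination e * h0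
  have hb : b = 0 := by
    by_contra hb
    have : 0 < b ^ 2 * (e * f - g ^ 2) := mul_pos (by positivity) hd
    nlinarith [sq_nonneg (a * e + b * g)]
  have he : e ≠ 0 := by
    intro he
    rw [he] at hd
    nlinarith [sq_nonneg g]
  have ha : a = 0 := by
    subst hb
    simpa [he] using h1
  apply complexify_ne_zero.1 hr.1
  simp [ha, hb]

theorem RealEquation.secantLine (R : RealEquation Φ N κ) (hX : Rep X (complexify x))
    (hY : Rep Y (complexify y)) (hne : X ≠ Y) (hx : Matrix.toBilin' N x x ≠ 0)
    (hy : Matrix.toBilin' N y y ≠ 0)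
    (hd : Matrix.toBilin' N x x * Matrix.toBilin' N y y - Matrix.toBilin' N x y ^ 2 < 0) :
    Φ.SecantLine (join X Y) := by
  have hκ := R.ne_zero
  set e := Matrix.toBilin' N x x with he
  set f := Matrix.toBilin' N y y with hf
  set g := Matrix.toBilin' N x y with hg
  set w := Real.sqrt (g ^ 2 - e * f) with hw
  have hw2 : w ^ 2 = g ^ 2 - e * f := Real.sq_sqrt (by linarith)
  have hw0 : w ≠ 0 := (Real.sqrt_pos.2 (by linarith)).ne'
  have hw2' : (w : ℂ) ^ 2 = g ^ 2 - e * f := by exact_mod_cast hw2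
  obtain ⟨U, V, hU, hV, ⟨hUV, h1, h2, h3, h4⟩, -⟩ := exists_cuts (Φ := Φ) (w := κ * w) hX hY
    (hX.linearIndependent hY hne) (R.form_eq x x) (R.form_eq y y) (R.form_eq x y)
    (mul_ne_zero hκ (by exact_mod_cast hx)) (mul_ne_zero hκ (by exact_mod_cast hy))
    (by rw [mul_pow, hw2', ← he, ← hf, ← hg]; ring) (mul_ne_zero hκ (by exact_mod_cast hw0))
  rw [← he, ← hg] at hU hV
  refine ⟨U, V, hUV, isRealPoint_iff.2 ⟨(1 : ℝ) • y + ((w - g) / e) • x, ?_⟩,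
    isRealPoint_iff.2 ⟨(1 : ℝ) • y + ((-w - g) / e) • x, ?_⟩, h1, h2, h3, h4⟩
  · rw [complexify_combination]
    convert hU using 2
    · simp
    · push_cast
      congr 1
      field_simp
  · rw [complexify_combination]
    convert hV using 2
    · simp
    · push_cast
      congr 1
      field_simp

theorem Conic.SecantLine.not_exteriorLine {p : Line} (h : Φ.SecantLine p) :
    ¬ Φ.ExteriorLine p := by
  obtain ⟨U, -, -, hU, -, hon, -, hc, -⟩ := h
  exact fun H => H U hU hon hc

end

section

variable {Φ : Conic} {N : Matrix (Fin 3) (Fin 3) ℝ} {κ : ℂ} {X Y : Point} {x y : Fin 3 → ℝ}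

/-! ### Magnitudes of the sides -/

/-- For `S = √(1 - g²)`, `exp(iθ) = η g + i S = η (g + i η S)`, and `g - i η S` is the inverse of `g
+ i η S`. -/
theorem exp_two_arccos {g η : ℝ} (hη : η * η = 1) (hg : g ^ 2 < 1) :
    Complex.exp (2 * (Real.arccos (η * g) : ℂ) * Complex.I) =
      (g + (η * Real.sqrt (1 - g ^ 2) : ℝ) * Complex.I) /
        (g - (η * Real.sqrt (1 - g ^ 2) : ℝ) * Complex.I) := by
  have hη2 : η ^ 2 = 1 := by rw [sq, hη]
  have hsq : (η * g) ^ 2 < 1 := by rw [mul_pow, hη2, one_mul]; exact hg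
  have h1 : |η * g| < 1 := by rwa [sq_lt_one_iff_abs_lt_one] at hsq
  have hc : Real.cos (Real.arccos (η * g)) = η * g :=
    Real.cos_arccos (abs_lt.1 h1).1.le (abs_lt.1 h1).2.le
  have hs : Real.sin (Real.arccos (η * g)) = Real.sqrt (1 - g ^ 2) := by
    rw [Real.sin_arccos, mul_pow, hη2, one_mul]
  set S := Real.sqrt (1 - g ^ 2) with hS
  have hS2 : S ^ 2 = 1 - g ^ 2 := Real.sq_sqrt (by linarith)
  have hS2' : (S : ℂ) ^ 2 = 1 - g ^ 2 := by exact_mod_cast hS2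
  have hη2' : (η : ℂ) ^ 2 = 1 := by exact_mod_cast hη2
  have hexp : Complex.exp (Real.arccos (η * g) * Complex.I) = η * g + S * Complex.I := by
    rw [Complex.exp_mul_I, ← Complex.ofReal_cos, ← Complex.ofReal_sin, hc, hs]
    push_cast
    ring
  have hI := Complex.I_sq
  have hmul : (g + (η * S : ℝ) * Complex.I) * (g - (η * S : ℝ) * Complex.I) = 1 := by
    push_cast
    linear_combination hS2' + S ^ 2 * hη2' - η ^ 2 * S ^ 2 * hI
  rw [mul_assoc, two_mul, Complex.exp_add, hexp, eq_div_iff (right_ne_zero_of_mul_eq_one hmul)]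
  push_cast at hmul ⊢
  linear_combination (g + η * S * Complex.I) * hmul +
    (g ^ 2 - S ^ 2 * Complex.I ^ 2) * (g - η * S * Complex.I) * hη2'

theorem exp_two_mul_eq {d C S : ℝ} (hc : Real.cosh d = C) (hs : Real.sinh d = S) :
    Complex.exp (2 * (d : ℂ)) = (C + S) / (C - S) ∧ C - S ≠ 0 := by
  have h1 : C ^ 2 - S ^ 2 = 1 := by rw [← hc, ← hs, Real.cosh_sq]; ring
  have h2 : (C + S) * (C - S) = 1 := by linear_combination h1
  have h3 := right_ne_zero_of_mul_eq_one h2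
  refine ⟨?_, h3⟩
  have h4 : Real.exp d = C + S := by rw [← hc, ← hs, Real.cosh_add_sinh]
  have h5 : Real.exp (2 * d) = (C + S) / (C - S) := by
    rw [two_mul, Real.exp_add, h4, eq_div_iff h3]
    linear_combination (C + S) * h2
  have : Complex.exp (2 * (d : ℂ)) = ((Real.exp (2 * d) : ℝ) : ℂ) := by push_cast; rfl
  rw [this, h5]
  push_cast
  rfl

/-- A translation of a segment, with the determinations of an angle prescribed by a sign. -/
theorem RealEquation.exists_translation (R : RealEquation Φ N κ) (hX : Rep X (complexify x))
    (hY : Rep Y (complexify y)) (hne : X ≠ Y) {e f g η : ℝ} (hx : Matrix.toBilin' N x x = e)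
    (hy : Matrix.toBilin' N y y = f) (hg : Matrix.toBilin' N x y = g)
    (he : e = 1 ∨ e = -1) (hf : f = 1 ∨ f = -1) (hd : e * f - g ^ 2 ≠ 0)
    (hXI : Φ.Interior X ↔ e = -1) (hYI : Φ.Interior Y ↔ f = -1) (hη : η * η = 1) :
    ∃ t : Translation, Φ.Translates X Y t ∧ t.S = Real.sqrt |e * f - g ^ 2| ∧
      (0 < e * f - g ^ 2 → t.C = η * g) ∧ (e * f - g ^ 2 < 0 → t.C = |g|) ∧
      (t.u * t.C) ^ 2 = e * f * g ^ 2 ∧ (t.v * t.S) ^ 2 = 1 - e * f * g ^ 2 := by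
  have hκ := R.ne_zero
  have hxy := hX.linearIndependent hY hne
  have he0 : e ≠ 0 := by rcases he with rfl | rfl <;> norm_num
  have hf0 : f ≠ 0 := by rcases hf with rfl | rfl <;> norm_num
  have hI := Complex.I_sq
  have cuts : ∀ w : ℂ, w ≠ 0 → w ^ 2 = g ^ 2 - e * f → ∃ U V : Point, Φ.Cuts (join X Y) U V ∧
      crossRatio U V X Y = (g + w) / (g - w) ∧
      crossRatio U V (Φ.conj (join X Y) X) (Φ.conj (join X Y) Y) = (g + w) / (g - w) ∧
      crossRatio U V X (Φ.conj (join X Y) Y) = -((g + w) / (g - w)) ∧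
      crossRatio U V (Φ.conj (join X Y) X) Y = -((g + w) / (g - w)) := by
    intro w hw0 hw2
    obtain ⟨U, V, -, -, hc, h⟩ := exists_cuts (Φ := Φ) (w := κ * w) hX hY hxy (R.form_eq x x)
      (R.form_eq y y) (R.form_eq x y)
      (mul_ne_zero hκ (by rw [hx]; exact_mod_cast he0))
      (mul_ne_zero hκ (by rw [hy]; exact_mod_cast hf0))
      (by rw [mul_pow, hw2, hx, hy, hg]; ring) (mul_ne_zero hκ hw0)
    have hr : (κ * (Matrix.toBilin' N x y : ℝ) + κ * w) / (κ * (Matrix.toBilin' N x y : ℝ) - κ * w) =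
        (g + w) / (g - w) := by
      rw [hg, ← mul_add, ← mul_sub, mul_div_mul_left _ _ hκ]
    rw [hr] at h
    exact ⟨U, V, hc, h⟩
  rcases lt_or_gt_of_ne hd with hneg | hpos
  · have hsec : Φ.SecantLine (join X Y) := R.secantLine hX hY hne (by rwa [hx]) (by rwa [hy])
      (by rwa [hx, hy, hg])
    have habs : |e * f - g ^ 2| = g ^ 2 - e * f := by rw [abs_of_neg hneg]; ring
    rw [habs]
    set S := Real.sqrt (g ^ 2 - e * f) with hS
    have hS2 : S ^ 2 = g ^ 2 - e * f := Real.sq_sqrt (by linarith)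
    have hS0 : 0 < S := Real.sqrt_pos.2 (by linarith)
    have hS2' : (S : ℂ) ^ 2 = g ^ 2 - e * f := by exact_mod_cast hS2
    -- The root `w = ζ S` labels the intersections `U, V` so that the cross ratio is `(|g| + S)/(|g|
    -- - S)`, matching a nonnegative distance.
    obtain ⟨ζ, hζ, hζg⟩ : ∃ ζ : ℝ, ζ * ζ = 1 ∧ ζ * g = |g| := by
      rcases le_total 0 g with h | h
      · exact ⟨1, by norm_num, by rw [one_mul, abs_of_nonneg h]⟩
      · exact ⟨-1, by norm_num, by rw [abs_of_nonpos h]; ring⟩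
    have hζ0 : (ζ : ℂ) ≠ 0 := by exact_mod_cast left_ne_zero_of_mul_eq_one hζ
    have hζ2 : (ζ : ℂ) * ζ = 1 := by exact_mod_cast hζ
    obtain ⟨U, V, hc, h1, h2, h3, h4⟩ := cuts (ζ * S)
      (mul_ne_zero hζ0 (by exact_mod_cast hS0.ne'))
      (by rw [mul_pow, hS2']; linear_combination (g ^ 2 - e * f : ℂ) * hζ2)
    have hratio : ((g : ℂ) + ζ * S) / (g - ζ * S) = ((|g| : ℝ) + S) / ((|g| : ℝ) - S) := by
      rw [← hζg, ← mul_div_mul_left _ _ hζ0]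
      push_cast
      congr 1
      · linear_combination (S : ℂ) * hζ2
      · linear_combination -(S : ℂ) * hζ2
    have hratio' : -(((g : ℂ) + ζ * S) / (g - ζ * S)) = (S + (|g| : ℝ)) / (S - (|g| : ℝ)) := by
      rw [hratio, ← div_neg]
      congr 1 <;> ring
    rw [hratio'] at h3 h4
    rw [hratio] at h1 h2
    have hgsq : |g| ^ 2 = g ^ 2 := sq_abs g
    have hgsq' : ((|g| : ℝ) : ℂ) ^ 2 = (g : ℂ) ^ 2 := by exact_mod_cast hgsq
    -- Here `S² = g² - e f`. For endpoints of the same kind `|g|` is the hyperbolic cosine and `S`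
    -- the sine; for different kinds the roles are exchanged.
    have same : e * f = 1 → Real.cosh (Real.arsinh S) = |g| := by
      intro hef
      rw [Real.cosh_arsinh, hS2, hef]
      rw [show 1 + (g ^ 2 - 1) = g ^ 2 by ring, Real.sqrt_sq_eq_abs]
    have diff : e * f = -1 → Real.cosh (Real.arsinh |g|) = S := by
      intro hef
      rw [Real.cosh_arsinh, hS, hef, hgsq]
      congr 1
      ring
    have nonneg1 : 0 ≤ Real.arsinh S := Real.arsinh_nonneg_iff.2 hS0.le
    have nonneg2 : 0 ≤ Real.arsinh |g| := Real.arsinh_nonneg_iff.2 (abs_nonneg g)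
    rcases he with rfl | rfl <;> rcases hf with rfl | rfl
    · have hcosh := same (by norm_num)
      refine ⟨_, .extExt (Real.arsinh S) hsec (by rw [hXI]; norm_num) (by rw [hYI]; norm_num)
        ⟨nonneg1, U, V, hc, ?_⟩, Real.sinh_arsinh _, fun h => absurd h hneg.not_gt, fun _ => hcosh,
        ?_, ?_⟩
      · rw [h2, (exp_two_mul_eq hcosh (Real.sinh_arsinh S)).1]
      · rw [hcosh, one_mul, hgsq']; push_cast; ring
      · rw [Real.sinh_arsinh, mul_pow, hI, hS2']; push_cast; ring
    · have hcosh := diff (by norm_num)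
      refine ⟨_, .extInt (Real.arsinh |g|) hsec (by rw [hXI]; norm_num) (by rw [hYI])
        ⟨nonneg2, U, V, hc, ?_⟩, hcosh, fun h => absurd h hneg.not_gt,
        fun _ => Real.sinh_arsinh _, ?_, ?_⟩
      · rw [h4, (exp_two_mul_eq hcosh (Real.sinh_arsinh _)).1]
      · rw [Real.sinh_arsinh, mul_pow, hI, hgsq']; push_cast; ring
      · rw [hcosh, one_mul, hS2']; push_cast; ring
    · have hcosh := diff (by norm_num)
      refine ⟨_, .intExt (Real.arsinh |g|) hsec (by rw [hXI]) (by rw [hYI]; norm_num)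
        ⟨nonneg2, U, V, hc, ?_⟩, hcosh, fun h => absurd h hneg.not_gt,
        fun _ => Real.sinh_arsinh _, ?_, ?_⟩
      · rw [h3, (exp_two_mul_eq hcosh (Real.sinh_arsinh _)).1]
      · rw [Real.sinh_arsinh, mul_pow, hI, hgsq']; push_cast; ring
      · rw [hcosh, one_mul, hS2']; push_cast; ring
    · have hcosh := same (by norm_num)
      refine ⟨_, .intInt (Real.arsinh S) hsec (by rw [hXI]) (by rw [hYI])
        ⟨nonneg1, U, V, hc, ?_⟩, Real.sinh_arsinh _, fun h => absurd h hneg.not_gt, fun _ => hcosh,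
        ?_, ?_⟩
      · rw [h1, (exp_two_mul_eq hcosh (Real.sinh_arsinh S)).1]
      · rw [hcosh, one_mul, hgsq']; push_cast; ring
      · rw [Real.sinh_arsinh, mul_pow, hI, hS2']; push_cast; ring
  · have hext : Φ.ExteriorLine (join X Y) := R.exteriorLine hX hY hne (by rwa [hx, hy, hg])
    -- Forced by `e f > g² ≥ 0`.
    have hef : e * f = 1 := by
      rcases he with rfl | rfl <;> rcases hf with rfl | rfl <;> nlinarith [sq_nonneg g]
    have hef' : (e : ℂ) * f = 1 := by exact_mod_cast hef
    rw [abs_of_pos hpos]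
    rw [hef] at hpos ⊢
    set S := Real.sqrt (1 - g ^ 2) with hS
    have hS2 : S ^ 2 = 1 - g ^ 2 := Real.sq_sqrt hpos.le
    have hS0 : 0 < S := Real.sqrt_pos.2 hpos
    have hS2' : (S : ℂ) ^ 2 = 1 - g ^ 2 := by exact_mod_cast hS2
    have hη2 : η ^ 2 = 1 := by rw [sq, hη]
    have hη2' : (η : ℂ) ^ 2 = 1 := by exact_mod_cast hη2
    have hη0 : (η : ℂ) ≠ 0 := by exact_mod_cast left_ne_zero_of_mul_eq_one hη
    have hsq : (η * g) ^ 2 < 1 := by rw [mul_pow, hη2, one_mul]; linarith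
    have h1 : |η * g| < 1 := by rwa [sq_lt_one_iff_abs_lt_one] at hsq
    have hcos : Real.cos (Real.arccos (η * g)) = η * g :=
      Real.cos_arccos (abs_lt.1 h1).1.le (abs_lt.1 h1).2.le
    have hsin : Real.sin (Real.arccos (η * g)) = S := by
      rw [Real.sin_arccos, mul_pow, hη2, one_mul]
    -- The root `w = i η S`; replacing `η` by `-η` interchanges `U` and `V`, that is, `θ` and `π -
    -- θ`.
    obtain ⟨U, V, hc, hr, -⟩ := cuts ((η * S : ℝ) * Complex.I)
      (mul_ne_zero (by push_cast; exact mul_ne_zero hη0 (by exact_mod_cast hS0.ne')) Complex.I_ne_zero)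
      (by rw [mul_pow, hI, hef']; push_cast; linear_combination -hS2' - S ^ 2 * hη2')
    refine ⟨_, .angle (Real.arccos (η * g)) hext
      ⟨Real.arccos_pos.2 (abs_lt.1 h1).2, ?_, U, V, hc, ?_⟩, hsin, fun _ => hcos,
      fun h => absurd h hpos.not_gt, ?_, ?_⟩
    · refine lt_of_le_of_ne (Real.arccos_le_pi _) fun h => ?_
      rw [Real.arccos_eq_pi] at h
      linarith [(abs_lt.1 h1).1]
    · rw [hr, exp_two_arccos hη (by linarith)]
    · rw [hcos]; push_cast; linear_combination (g : ℂ) ^ 2 * hη2' - (g : ℂ) ^ 2 * hef'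
    · rw [hsin, one_mul, hS2']; linear_combination (g : ℂ) ^ 2 * hef'

end

section

variable {Φ : Conic} {N : Matrix (Fin 3) (Fin 3) ℝ} {κ : ℂ}

/-! ### Real triangles -/

theorem Fin.eq_add_of_ne {i j : Fin 3} (h : j ≠ i) : j = i + 1 ∨ j = i + 2 := by
  revert i j
  decide

/-- Normalised real homogeneous coordinates of a triangle and of its polar triangle. -/
structure RealTriple (Φ : Conic) (N : Matrix (Fin 3) (Fin 3) ℝ) (κ : ℂ) (T T' : Fin 3 → Point)
    (x x' : Fin 3 → Fin 3 → ℝ) (k : Fin 3 → ℝ) : Prop where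
  eqn : RealEquation Φ N κ
  rep : ∀ i, Rep (T i) (complexify (x i))
  rep' : ∀ i, Rep (T' i) (complexify (x' i))
  norm : ∀ i, Matrix.toBilin' N (x i) (x i) = 1 ∨ Matrix.toBilin' N (x i) (x i) = -1
  norm' : ∀ i, Matrix.toBilin' N (x' i) (x' i) = 1 ∨ Matrix.toBilin' N (x' i) (x' i) = -1
  dual : ∀ i j, Matrix.toBilin' N (x i) (x' j) = if i = j then k i else 0
  pos : ∀ i, 0 < k i

theorem RealEquation.exists_normal_rep (R : RealEquation Φ N κ) {P : Point} {w : Fin 3 → ℝ}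
    (hP : Rep P (complexify w)) (h : ¬ Φ.Contains P) :
    ∃ x, Rep P (complexify x) ∧ (Matrix.toBilin' N x x = 1 ∨ Matrix.toBilin' N x x = -1) := by
  rw [hP.contains_iff, R.form_eq_zero] at h
  set q := Matrix.toBilin' N w w with hq
  set s := Real.sqrt |q| with hs
  have hs2 : s ^ 2 = |q| := Real.sq_sqrt (abs_nonneg q)
  have hs0 : 0 < s := Real.sqrt_pos.2 (abs_pos.2 h)
  -- The zero summand brings the vector into the form of the lemmas on combinations of two vectors.
  refine ⟨s⁻¹ • w + (0 : ℝ) • w, ?_, ?_⟩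
  · rw [complexify_combination, Complex.ofReal_zero, zero_smul, add_zero]
    exact hP.smul (by exact_mod_cast inv_ne_zero hs0.ne')
  · have : Matrix.toBilin' N (s⁻¹ • w + (0 : ℝ) • w) (s⁻¹ • w + (0 : ℝ) • w) = q / s ^ 2 := by
      rw [R.combination, ← hq]
      field_simp
      ring
    rw [this, hs2]
    rcases lt_or_gt_of_ne h with h | h
    · right; rw [abs_of_neg h]; field_simp
    · left; rw [abs_of_pos h]; field_simp

theorem exists_real_orthogonal (N : Matrix (Fin 3) (Fin 3) ℝ) (v w : Fin 3 → ℝ) :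
    ∃ n, n ≠ 0 ∧ Matrix.toBilin' N v n = 0 ∧ Matrix.toBilin' N w n = 0 := by
  let f : (Fin 3 → ℝ) →ₗ[ℝ] (ℝ × ℝ) := (Matrix.toBilin' N v).prod (Matrix.toBilin' N w)
  have hf : f.ker ≠ ⊥ := LinearMap.ker_ne_bot_of_finrank_lt (by simp)
  obtain ⟨n, hn, hn0⟩ := Submodule.exists_mem_ne_zero_of_ne_bot hf
  have : (Matrix.toBilin' N v n, Matrix.toBilin' N w n) = (0, 0) := hn
  rw [Prod.mk.injEq] at this
  exact ⟨n, hn0, this.1, this.2⟩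

theorem RealEquation.exists_realTriple (R : RealEquation Φ N κ) {T : Fin 3 → Point}
    (hT : Φ.GeneralPosition T) (hr : ∀ i, IsRealPoint (T i)) :
    ∃ x x' k, RealTriple Φ N κ T (Φ.polarTriangle T) x x' k := by
  have h1 : ∀ i, ∃ x, Rep (T i) (complexify x) ∧
      (Matrix.toBilin' N x x = 1 ∨ Matrix.toBilin' N x x = -1) := by
    intro i
    obtain ⟨w, hw⟩ := isRealPoint_iff.1 (hr i)
    exact R.exists_normal_rep hw (hT.vertex_off i)
  choose x hx hn using h1
  have hind := (Rep.independent_iff hx).1 hT.noncollinear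
  have h2 : ∀ i, ∃ y, Rep (Φ.polarTriangle T i) (complexify y) ∧
      (Matrix.toBilin' N y y = 1 ∨ Matrix.toBilin' N y y = -1) ∧
      (∀ j, j ≠ i → Matrix.toBilin' N (x j) y = 0) ∧ 0 < Matrix.toBilin' N (x i) y := by
    intro i
    obtain ⟨n, hn0, h1, h2⟩ := exists_real_orthogonal N (x (i + 1)) (x (i + 2))
    have hne := hT.ne (Fin.three_add i).2.2.2.2.2.2.2.2.1
    obtain ⟨P, hP⟩ := exists_point (complexify_ne_zero.2 hn0)
    have hrep : Rep (Φ.polarTriangle T i) (complexify n) := by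
      rw [Conic.polarTriangle, side, (hx _).join_eq (hx _),
        hP.pole_eq ((hx _).linearIndependent (hx _) hne)]
      · exact hP
      · rwa [R.form_eq_zero, R.comm]
      · rwa [R.form_eq_zero, R.comm]
    obtain ⟨y, hy, hyn⟩ := R.exists_normal_rep hrep (hT.polar_vertex_off i)
    have hort : ∀ j, j ≠ i → Matrix.toBilin' N (x j) y = 0 := by
      intro j hj
      rw [← R.form_eq_zero, Φ.form_comm, ← hy.mem_polar_iff, polar_polarTriangle hne,
        ← (hx j).on_iff, side]
      have : j = i + 1 ∨ j = i + 2 := Fin.eq_add_of_ne hj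
      rcases this with rfl | rfl
      · exact le_sup_left
      · exact le_sup_right
    have hk : Matrix.toBilin' N (x i) y ≠ 0 := by
      intro h0
      refine hy.1 (eq_zero_of_form_triple (Φ := Φ) hind fun j => ?_)
      rw [R.form_eq_zero]
      by_cases hj : j = i
      · rwa [hj]
      · exact hort j hj
    -- The sign of the polar vertex is still free and is chosen so that `k i > 0`; then `k i * S i`
    -- is the positive root of `-det G` for every side.
    rcases lt_or_gt_of_ne hk with h | h
    · refine ⟨(-1 : ℝ) • y + (0 : ℝ) • y, ?_, ?_, fun j hj => ?_, ?_⟩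
      · rw [complexify_combination, Complex.ofReal_zero, zero_smul, add_zero]
        exact hy.smul (by norm_num)
      · simpa using hyn
      · simp [hort j hj]
      · simpa using h
    · exact ⟨y, hy, hyn, hort, h⟩
  choose x' hx' hn' hort hpos using h2
  refine ⟨x, x', fun i => Matrix.toBilin' N (x i) (x' i), R, hx, hx', hn, hn', fun i j => ?_, hpos⟩
  by_cases h : i = j
  · subst h; simp
  · rw [if_neg h, hort j i h]

variable {T T' : Fin 3 → Point} {x x' : Fin 3 → Fin 3 → ℝ} {k : Fin 3 → ℝ}

theorem RealTriple.symm (D : RealTriple Φ N κ T T' x x' k) : RealTriple Φ N κ T' T x' x k where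
  eqn := D.eqn
  rep := D.rep'
  rep' := D.rep
  norm := D.norm'
  norm' := D.norm
  dual i j := by
    rw [D.eqn.comm, D.dual]
    by_cases h : i = j
    · subst h; simp
    · rw [if_neg h, if_neg (Ne.symm h)]
  pos := D.pos

theorem RealTriple.ne (D : RealTriple Φ N κ T T' x x' k) (i j : Fin 3) (hij : i ≠ j) :
    T i ≠ T j := by
  intro e
  obtain ⟨c, hc, h⟩ := (D.rep i).exists_smul (e ▸ D.rep j)
  have h1 : Φ.form (complexify (x j)) (complexify (x' i)) = 0 := by
    rw [D.eqn.form_eq_zero, D.dual, if_neg (Ne.symm hij)]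
  rw [h, map_smul, LinearMap.smul_apply, smul_eq_mul, mul_eq_zero, D.eqn.form_eq_zero, D.dual,
    if_pos rfl] at h1
  exact h1.elim hc (D.pos i).ne'

theorem RealTriple.side_eq (D : RealTriple Φ N κ T T' x x' k) (i : Fin 3) :
    side T i = Φ.polar (T' i) := by
  obtain ⟨-, -, -, -, -, -, n10, n20, n12, -⟩ := Fin.three_add i
  rw [side, (D.rep _).join_eq (D.rep _), (D.rep' i).polar_eq_span
    ((D.rep _).linearIndependent (D.rep _) (D.ne _ _ n12))]
  · rw [D.eqn.form_eq_zero, D.eqn.comm, D.dual, if_neg n10]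
  · rw [D.eqn.form_eq_zero, D.eqn.comm, D.dual, if_neg n20]

theorem RealEquation.det_gram_nonpos (R : RealEquation Φ N κ) (v : Fin 3 → Fin 3 → ℝ) :
    (gram N v).det ≤ 0 := by
  rw [det_gram]
  exact mul_nonpos_of_nonpos_of_nonneg R.det_neg.le (sq_nonneg _)

/-- The relations between the Gram matrices, in terms of the sine-like functions. -/
theorem RealTriple.relations (D : RealTriple Φ N κ T T' x x' k) (i : Fin 3) :
    Matrix.toBilin' N (x (i + 1)) (x (i + 1)) * Matrix.toBilin' N (x (i + 2)) (x (i + 2)) -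
      Matrix.toBilin' N (x (i + 1)) (x (i + 2)) ^ 2 =
      -Matrix.toBilin' N (x' i) (x' i) *
        |Matrix.toBilin' N (x (i + 1)) (x (i + 1)) * Matrix.toBilin' N (x (i + 2)) (x (i + 2)) -
          Matrix.toBilin' N (x (i + 1)) (x (i + 2)) ^ 2| ∧
    Matrix.toBilin' N (x (i + 1)) (x (i + 1)) * Matrix.toBilin' N (x (i + 2)) (x (i + 2)) -
      Matrix.toBilin' N (x (i + 1)) (x (i + 2)) ^ 2 ≠ 0 ∧
    (k i * Real.sqrt |Matrix.toBilin' N (x (i + 1)) (x (i + 1)) *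
      Matrix.toBilin' N (x (i + 2)) (x (i + 2)) - Matrix.toBilin' N (x (i + 1)) (x (i + 2)) ^ 2|) =
        Real.sqrt (-(gram N x).det) ∧
    (gram N x).det * Matrix.toBilin' N (x' (i + 1)) (x' (i + 2)) = k (i + 1) * k (i + 2) *
        (Matrix.toBilin' N (x (i + 2)) (x i) * Matrix.toBilin' N (x i) (x (i + 1)) -
          Matrix.toBilin' N (x i) (x i) * Matrix.toBilin' N (x (i + 1)) (x (i + 2))) ∧
    (gram N x).det < 0 := by
  have h0 := (gram_dual D.eqn.symm (fun i => (D.pos i).ne') D.dual).1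
  have hneg : (gram N x).det < 0 := lt_of_le_of_ne (D.eqn.det_gram_nonpos x) h0
  obtain ⟨h1, h2⟩ := gram_relations D.eqn.symm (fun i => (D.pos i).ne') D.dual i
  refine ⟨?_, ?_, ?_, h2, hneg⟩
  all_goals
    have hk := D.pos i
    have hn := D.norm' i
    set d := Matrix.toBilin' N (x (i + 1)) (x (i + 1)) * Matrix.toBilin' N (x (i + 2)) (x (i + 2)) -
      Matrix.toBilin' N (x (i + 1)) (x (i + 2)) ^ 2
    have hk2 : 0 < k i ^ 2 := by positivity
  · rcases hn with hn | hn
    · rw [hn] at h1 ⊢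
      have : d < 0 := by nlinarith
      rw [abs_of_neg this]; ring
    · rw [hn] at h1 ⊢
      have : 0 < d := by nlinarith
      rw [abs_of_pos this]; ring
  · intro hd
    rw [hd, mul_zero] at h1
    rcases hn with hn | hn <;> rw [hn] at h1 <;> linarith
  · symm
    rw [Real.sqrt_eq_iff_mul_self_eq (by linarith) (by positivity)]
    have hs := Real.mul_self_sqrt (abs_nonneg d)
    have : |d| * k i ^ 2 = -(gram N x).det := by
      rcases hn with hn | hn
      · rw [hn] at h1
        have : d < 0 := by nlinarith
        rw [abs_of_neg this]; linarith
      · rw [hn] at h1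
        have : 0 < d := by nlinarith
        rw [abs_of_pos this]; linarith
    linear_combination -(k i ^ 2 * hs) - this

/-- The off-diagonal Gram relation after division by `k (i + 1) * k (i + 2)`, where `-det G = k (i +
1) k (i + 2) S (i + 1) S (i + 2)`. This is the common source of the elliptic and hyperbolic laws. -/
theorem RealTriple.law (D : RealTriple Φ N κ T T' x x' k) {S : Fin 3 → ℝ}
    (hS : ∀ i, S i = Real.sqrt |Matrix.toBilin' N (x (i + 1)) (x (i + 1)) *
      Matrix.toBilin' N (x (i + 2)) (x (i + 2)) - Matrix.toBilin' N (x (i + 1)) (x (i + 2)) ^ 2|)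
    (i : Fin 3) :
    Matrix.toBilin' N (x i) (x i) * Matrix.toBilin' N (x (i + 1)) (x (i + 2)) =
      Matrix.toBilin' N (x (i + 2)) (x i) * Matrix.toBilin' N (x i) (x (i + 1)) +
        S (i + 1) * S (i + 2) * Matrix.toBilin' N (x' (i + 1)) (x' (i + 2)) := by
  have h1 := (D.relations (i + 1)).2.2.1
  have h2 := (D.relations (i + 2)).2.2.1
  obtain ⟨-, -, -, h3, hneg⟩ := D.relations i
  rw [← hS] at h1 h2
  have h4 := Real.mul_self_sqrt (show 0 ≤ -(gram N x).det by linarith)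
  have h5 : k (i + 1) * k (i + 2) * (S (i + 1) * S (i + 2)) = -(gram N x).det := by
    rw [← h4]
    nth_rewrite 1 [← h1]
    rw [← h2]
    ring
  apply mul_left_cancel₀ (mul_pos (D.pos (i + 1)) (D.pos (i + 2))).ne'
  linear_combination h3 - Matrix.toBilin' N (x' (i + 1)) (x' (i + 2)) * h5

/-- The polar of a vertex is a side of the dual triangle, and because `det N < 0` the Gram minor of
that side has the sign opposite to the norm of the vertex. -/
theorem RealTriple.interior_iff (D : RealTriple Φ N κ T T' x x' k) (i : Fin 3) :
    Φ.Interior (T i) ↔ Matrix.toBilin' N (x i) (x i) = -1 := by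
  have hne := D.symm.ne _ _ (Fin.three_add i).2.2.2.2.2.2.2.2.1
  obtain ⟨h1, h2, -⟩ := D.symm.relations i
  rw [Conic.Interior, ← D.symm.side_eq, side]
  have hn0 : ∀ j, Matrix.toBilin' N (x' j) (x' j) ≠ 0 := by
    intro j
    rcases D.norm' j with h | h <;> rw [h] <;> norm_num
  rcases D.norm i with h | h
  · rw [h] at h1 ⊢
    have hneg := abs_pos.2 h2
    have : ¬ Φ.ExteriorLine (join (T' (i + 1)) (T' (i + 2))) :=
      (D.eqn.secantLine (D.rep' _) (D.rep' _) hne (hn0 _) (hn0 _) (by linarith)).not_exteriorLine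
    simp only [this, false_iff]
    norm_num
  · rw [h] at h1 ⊢
    have hneg := abs_pos.2 h2
    have : Φ.ExteriorLine (join (T' (i + 1)) (T' (i + 2))) :=
      D.eqn.exteriorLine (D.rep' _) (D.rep' _) hne (by linarith)
    simp [this]

/-- If the conic has real points, then so has the line joining two interior points. -/
theorem RealEquation.one_le_sq (R : RealEquation Φ N κ) (h : ¬ Φ.IsImaginary) {x y : Fin 3 → ℝ}
    (hx : Matrix.toBilin' N x x = -1) (hy : Matrix.toBilin' N y y = -1) :
    1 ≤ Matrix.toBilin' N x y ^ 2 := by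
  simp only [Conic.IsImaginary, not_forall, not_not] at h
  obtain ⟨P, hP, hc⟩ := h
  obtain ⟨u, hu⟩ := isRealPoint_iff.1 hP
  have huu := R.form_eq_zero.1 (hu.contains_iff.1 hc)
  have h1 := R.det_gram_nonpos ![u, x, y]
  rw [det_gram_eq R.symm _ 0] at h1
  change Matrix.toBilin' N u u * (Matrix.toBilin' N x x * Matrix.toBilin' N y y) +
    2 * Matrix.toBilin' N x y * Matrix.toBilin' N y u * Matrix.toBilin' N u x -
    Matrix.toBilin' N u u * Matrix.toBilin' N x y ^ 2 -
    Matrix.toBilin' N x x * Matrix.toBilin' N y u ^ 2 -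
    Matrix.toBilin' N y y * Matrix.toBilin' N u x ^ 2 ≤ 0 at h1
  rw [huu, hx, hy] at h1
  by_contra! hlt
  -- With `g = ⟨x,y⟩`, the Gram inequality for `u, x, y` reads `(⟨y,u⟩ + g⟨u,x⟩)² + (1 - g²)⟨u,x⟩² ≤
  -- 0`.
  have hux : Matrix.toBilin' N u x = 0 := by
    by_contra h0
    have : 0 < Matrix.toBilin' N u x ^ 2 := by positivity
    nlinarith [sq_nonneg (Matrix.toBilin' N y u + Matrix.toBilin' N x y * Matrix.toBilin' N u x)]
  -- For the triple `u, x, z` the inequality shrinks to `⟨z,u⟩² ≤ 0`, so `u` would be in the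
  -- radical.
  have hz : ∀ z, Matrix.toBilin' N u z = 0 := by
    intro z
    have h2 := R.det_gram_nonpos ![u, x, z]
    rw [det_gram_eq R.symm _ 0] at h2
    change Matrix.toBilin' N u u * (Matrix.toBilin' N x x * Matrix.toBilin' N z z) +
      2 * Matrix.toBilin' N x z * Matrix.toBilin' N z u * Matrix.toBilin' N u x -
      Matrix.toBilin' N u u * Matrix.toBilin' N x z ^ 2 -
      Matrix.toBilin' N x x * Matrix.toBilin' N z u ^ 2 -
      Matrix.toBilin' N z z * Matrix.toBilin' N u x ^ 2 ≤ 0 at h2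
    rw [huu, hx, hux] at h2
    rw [R.comm]
    nlinarith [sq_nonneg (Matrix.toBilin' N z u)]
  have hnd : (Matrix.toBilin' N).Nondegenerate :=
    LinearMap.BilinForm.nondegenerate_toBilin'_iff_det_ne_zero.2 R.det_neg.ne
  exact complexify_ne_zero.1 hu.1 (hnd.1 u hz)

/-- Signs adapted to the interior vertices of a triangle. -/
theorem exists_signs {e g : Fin 3 → ℝ} (h : (∀ i, e i = -1) → g 0 * g 1 * g 2 < 0) :
    ∃ s : Fin 3 → ℝ, (∀ i, s i = 1 ∨ s i = -1) ∧ (∀ i, s (i + 1) * s (i + 2) = s i) ∧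
      ∀ i, e (i + 1) = -1 → e (i + 2) = -1 → s i * g i ≤ 0 := by
  have hsgn : ∀ a : ℝ, ∃ s : ℝ, (s = 1 ∨ s = -1) ∧ s * a ≤ 0 ∧ s * s = 1 ∧ s * a = -|a| := by
    intro a
    rcases le_total a 0 with h | h
    · exact ⟨1, .inl rfl, by linarith, by norm_num, by rw [abs_of_nonpos h]; ring⟩
    · exact ⟨-1, .inr rfl, by linarith, by norm_num, by rw [abs_of_nonneg h]; ring⟩
  -- With three interior vertices every `s i` is prescribed, and the hypothesis on the product of
  -- the `g i` is what makes `s 0 * s 1 * s 2 = 1`.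
  by_cases hall : ∀ i, e i = -1
  · have hneg := h hall
    choose s hs hsg hss hsa using fun i => hsgn (g i)
    have hp : s 0 * s 1 * s 2 = 1 := by
      have h1 : (s 0 * s 1 * s 2) * (g 0 * g 1 * g 2) = -(|g 0| * |g 1| * |g 2|) := by
        linear_combination s 1 * g 1 * s 2 * g 2 * hsa 0 - |g 0| * s 2 * g 2 * hsa 1 +
          |g 0| * |g 1| * hsa 2
      have h2 : |g 0| * |g 1| * |g 2| = -(g 0 * g 1 * g 2) := by
        rw [← abs_mul, ← abs_mul, abs_of_neg hneg]
      rw [h2, neg_neg] at h1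
      exact mul_right_cancel₀ hneg.ne (by rw [h1, one_mul])
    refine ⟨s, hs, fun i => ?_, fun i _ _ => hsg i⟩
    fin_cases i
    · change s 1 * s 2 = s 0
      linear_combination s 0 * hp - s 1 * s 2 * hss 0
    · change s 2 * s 0 = s 1
      linear_combination s 1 * hp - s 0 * s 2 * hss 1
    · change s 0 * s 1 = s 2
      linear_combination s 2 * hp - s 0 * s 1 * hss 2
  · simp only [not_forall] at hall
    obtain ⟨j, hj⟩ := hall
    obtain ⟨s, hs, hsg, hss, -⟩ := hsgn (g j)
    -- With vertex `j` not interior, only the side opposite to it can carry a condition; the triple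
    -- `s, s, 1` at `j, j + 1, j + 2` meets it.
    refine ⟨fun i => if i = j + 2 then 1 else s, fun i => ?_, fun i => ?_, fun i h1 h2 => ?_⟩
    · dsimp only
      split_ifs
      · exact .inl rfl
      · exact hs
    · fin_cases i <;> fin_cases j <;> simp [hss]
    · have : i = j := by
        have h3 : i + 1 ≠ j := by rintro rfl; exact hj h1
        have h4 : i + 2 ≠ j := by rintro rfl; exact hj h2
        by_contra hij
        rcases Fin.eq_add_of_ne (Ne.symm hij) with h | h
        · exact h3 h.symm
        · exact h4 h.symm
      subst this
      dsimp only
      rw [if_neg (Fin.three_add i).2.2.2.2.2.1]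
      exact hsg

end

/-! ### Elliptic and hyperbolic laws for real triangles -/

section

variable {Φ : Conic} {N : Matrix (Fin 3) (Fin 3) ℝ} {κ : ℂ}
variable {T T' : Fin 3 → Point} {x x' : Fin 3 → Fin 3 → ℝ} {k : Fin 3 → ℝ}

/-- Translations of the sides of a real triangle; the determinations of the angles are prescribed
by a sign. -/
theorem RealTriple.exists_translations (D : RealTriple Φ N κ T T' x x' k) {η : ℝ}
    (hη : η * η = 1) :
    ∃ t : Fin 3 → Translation, Φ.TranslatesSides T t ∧
      (∀ i, (t i).S = Real.sqrt |Matrix.toBilin' N (x (i + 1)) (x (i + 1)) *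
        Matrix.toBilin' N (x (i + 2)) (x (i + 2)) - Matrix.toBilin' N (x (i + 1)) (x (i + 2)) ^ 2|) ∧
      (∀ i, Matrix.toBilin' N (x' i) (x' i) = -1 →
        (t i).C = η * Matrix.toBilin' N (x (i + 1)) (x (i + 2))) ∧
      ∀ i, Matrix.toBilin' N (x' i) (x' i) = 1 →
        (t i).C = |Matrix.toBilin' N (x (i + 1)) (x (i + 2))| := by
  have h : ∀ i, _ := fun i => D.eqn.exists_translation (D.rep (i + 1)) (D.rep (i + 2))
    (D.ne _ _ (Fin.three_add i).2.2.2.2.2.2.2.2.1) rfl rfl rfl (D.norm _) (D.norm _)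
    (D.relations i).2.1 (D.interior_iff _) (D.interior_iff _) hη
  choose t ht hS hpos hneg hcc hss using h
  have hrel := D.relations
  refine ⟨t, ⟨ht, fun o i => ?_⟩, hS, fun i hi => hpos i ?_, fun i hi => hneg i ?_⟩
  · have hne := D.ne _ _ (Fin.three_add i).2.2.2.2.2.2.2.2.1
    have hκ := D.eqn.ne_zero
    have hx := D.eqn.form_eq (x (i + 1)) (x (i + 1))
    have hy := D.eqn.form_eq (x (i + 2)) (x (i + 2))
    have hg := D.eqn.form_eq (x (i + 1)) (x (i + 2))
    have hd := (hrel i).2.1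
    have hcc := hcc i
    have hss := hss i
    have he := D.norm (i + 1)
    have hf := D.norm (i + 2)
    set e := Matrix.toBilin' N (x (i + 1)) (x (i + 1))
    set f := Matrix.toBilin' N (x (i + 2)) (x (i + 2))
    set g := Matrix.toBilin' N (x (i + 1)) (x (i + 2))
    have hef : ((e : ℂ) * f) * (e * f) = 1 := by
      rcases he with he | he <;> rcases hf with hf | hf <;> rw [he, hf] <;> norm_num
    have he0 : (e : ℂ) ≠ 0 := by rintro h0; rw [h0] at hef; simp at hef
    have hf0 : (f : ℂ) ≠ 0 := by rintro h0; rw [h0] at hef; simp at hef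
    have hκ2 : κ ^ 2 ≠ 0 := pow_ne_zero _ hκ
    constructor
    -- Only the squares have to be compared, whatever the orientation; `κ` cancels and `1/(e f) = e
    -- f`.
    · apply sq_eq_sq_iff_eq_or_eq_neg.1
      rw [hcc]
      have h1 := cc_sq (Φ := Φ) (D.rep (i + 1)) (D.rep (i + 2))
        (by rw [hx]; exact mul_ne_zero hκ he0) (by rw [hy]; exact mul_ne_zero hκ hf0) (o.isMid i)
      rw [hx, hy, hg] at h1
      apply mul_left_cancel₀ hκ2
      rw [Conic.Orientation.cc]
      linear_combination e * f * h1 -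
        κ ^ 2 * Φ.cc (T (i + 1)) (T (i + 2)) (o.mid i) ^ 2 * hef
    · apply sq_eq_sq_iff_eq_or_eq_neg.1
      rw [hss]
      have hd' : (e : ℂ) * f - g ^ 2 ≠ 0 := by exact_mod_cast hd
      have h1 := ss_sq (Φ := Φ) (D.rep (i + 1)) (D.rep (i + 2)) hne
        (by rw [hx]; exact mul_ne_zero hκ he0) (by rw [hy]; exact mul_ne_zero hκ hf0)
        (by
          rw [hx, hy, hg]
          have : κ * e * (κ * f) - (κ * g) ^ 2 = κ ^ 2 * (e * f - g ^ 2) := by ring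
          rw [this]
          exact mul_ne_zero hκ2 hd') (o.isComp i)
      rw [hx, hy, hg] at h1
      apply mul_left_cancel₀ hκ2
      rw [Conic.Orientation.ss]
      linear_combination e * f * h1 -
        κ ^ 2 * (Φ.ss (T (i + 1)) (T (i + 2)) (o.comp i) ^ 2 - 1) * hef
  · obtain ⟨h1, h2, -⟩ := hrel i
    have := abs_pos.2 h2
    rw [hi] at h1
    linarith
  · obtain ⟨h1, h2, -⟩ := hrel i
    have := abs_pos.2 h2
    rw [hi] at h1
    linarith

theorem RealTriple.ellipticLaws (D : RealTriple Φ N κ T T' x x' k) (him : Φ.IsImaginary)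
    {t t' : Fin 3 → Translation}
    (hS : ∀ i, (t i).S = Real.sqrt |Matrix.toBilin' N (x (i + 1)) (x (i + 1)) *
      Matrix.toBilin' N (x (i + 2)) (x (i + 2)) - Matrix.toBilin' N (x (i + 1)) (x (i + 2)) ^ 2|)
    (hS' : ∀ i, (t' i).S = Real.sqrt |Matrix.toBilin' N (x' (i + 1)) (x' (i + 1)) *
      Matrix.toBilin' N (x' (i + 2)) (x' (i + 2)) - Matrix.toBilin' N (x' (i + 1)) (x' (i + 2)) ^ 2|)
    (hC : ∀ i, Matrix.toBilin' N (x' i) (x' i) = -1 →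
      (t i).C = -1 * Matrix.toBilin' N (x (i + 1)) (x (i + 2)))
    (hC' : ∀ i, Matrix.toBilin' N (x i) (x i) = -1 →
      (t' i).C = 1 * Matrix.toBilin' N (x' (i + 1)) (x' (i + 2))) :
    EllipticLaws t t' := by
  intro i
  -- On a conic without real points the interior condition is vacuous, so all norms are `-1`.
  have hI : ∀ P, Φ.Interior P := fun P Q hQ _ => him Q hQ
  have h1 := fun j => (D.interior_iff j).1 (hI _)
  have h2 := fun j => (D.symm.interior_iff j).1 (hI _)
  have l1 := D.law hS i
  have l2 := D.symm.law hS' i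
  rw [h1] at l1
  rw [h2] at l2
  rw [hC i (h2 i), hC (i + 1) (h2 _), hC (i + 2) (h2 _), hC' i (h1 i), hC' (i + 1) (h1 _),
    hC' (i + 2) (h1 _)]
  obtain ⟨e11, e12, e21, e22, -⟩ := Fin.three_add i
  rw [e11, e12, e21, e22]
  constructor
  · linear_combination l1
  · linear_combination -l2

theorem RealTriple.sgn_eq (D : RealTriple Φ N κ T T' x x' k) (i : Fin 3) :
    Φ.sgn (T i) = Matrix.toBilin' N (x i) (x i) := by
  unfold Conic.sgn
  split_ifs with h
  · exact ((D.interior_iff i).1 h).symm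
  · rw [D.interior_iff] at h
    exact ((D.norm i).resolve_right h).symm

/-- The product of the three scalar products of interior vertices. -/
theorem RealTriple.prod_neg (D : RealTriple Φ N κ T T' x x' k) (hre : ¬ Φ.IsImaginary)
    (hall : ∀ i, Matrix.toBilin' N (x i) (x i) = -1) :
    Matrix.toBilin' N (x (0 + 1)) (x (0 + 2)) * Matrix.toBilin' N (x (1 + 1)) (x (1 + 2)) *
      Matrix.toBilin' N (x (2 + 1)) (x (2 + 2)) < 0 := by
  have hneg := (D.relations 0).2.2.2.2
  rw [det_gram_eq D.eqn.symm x 0] at hneg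
  have h1 := D.eqn.one_le_sq hre (hall 1) (hall 2)
  have h2 := D.eqn.one_le_sq hre (hall 2) (hall 0)
  have h3 := D.eqn.one_le_sq hre (hall 0) (hall 1)
  simp only [hall] at hneg
  change _ + 2 * Matrix.toBilin' N (x 1) (x 2) * Matrix.toBilin' N (x 2) (x 0) *
    Matrix.toBilin' N (x 0) (x 1) - _ * Matrix.toBilin' N (x 1) (x 2) ^ 2 -
    _ * Matrix.toBilin' N (x 2) (x 0) ^ 2 - _ * Matrix.toBilin' N (x 0) (x 1) ^ 2 < 0 at hneg
  change Matrix.toBilin' N (x 1) (x 2) * Matrix.toBilin' N (x 2) (x 0) *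
    Matrix.toBilin' N (x 0) (x 1) < 0
  -- The determinant is `-1 + 2 g₀ g₁ g₂ + g₀² + g₁² + g₂² < 0` and every `g²` is at least `1`, so
  -- the product is below `-1`.
  linarith

/-- Two interior vertices of a triangle leave no interior vertex for the polar triangle. -/
theorem RealTriple.polar_exterior (D : RealTriple Φ N κ T T' x x' k) (hre : ¬ Φ.IsImaginary)
    {i : Fin 3} (h1 : Matrix.toBilin' N (x (i + 1)) (x (i + 1)) = -1)
    (h2 : Matrix.toBilin' N (x (i + 2)) (x (i + 2)) = -1) (j : Fin 3) :
    Matrix.toBilin' N (x' j) (x' j) ≠ -1 := by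
  intro h3
  -- The vertices `T l` and `T' j` are conjugate, and two interior points have a scalar product of
  -- square at least `1`.
  have key : ∀ l, l ≠ j → Matrix.toBilin' N (x l) (x l) ≠ -1 := by
    intro l hl h4
    have := D.eqn.one_le_sq hre h4 h3
    rw [D.dual, if_neg hl] at this
    norm_num at this
  by_cases hj : i + 1 = j
  · exact key (i + 2) (hj ▸ (Fin.three_add i).2.2.2.2.2.2.2.2.2) h2
  · exact key (i + 1) hj h1

/-- One sign vector must serve both triangles. There is no conflict: a side with two interior
endpoints in one triangle leaves the other without interior vertices. -/
theorem RealTriple.exists_signs (D : RealTriple Φ N κ T T' x x' k) (hre : ¬ Φ.IsImaginary) :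
    ∃ s : Fin 3 → ℝ, (∀ i, s i = 1 ∨ s i = -1) ∧ (∀ i, s (i + 1) * s (i + 2) = s i) ∧
      (∀ i, Matrix.toBilin' N (x (i + 1)) (x (i + 1)) = -1 →
        Matrix.toBilin' N (x (i + 2)) (x (i + 2)) = -1 →
        s i * Matrix.toBilin' N (x (i + 1)) (x (i + 2)) ≤ 0) ∧
      ∀ i, Matrix.toBilin' N (x' (i + 1)) (x' (i + 1)) = -1 →
        Matrix.toBilin' N (x' (i + 2)) (x' (i + 2)) = -1 →
        s i * Matrix.toBilin' N (x' (i + 1)) (x' (i + 2)) ≤ 0 := by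
  by_cases h : ∃ i, Matrix.toBilin' N (x (i + 1)) (x (i + 1)) = -1 ∧
      Matrix.toBilin' N (x (i + 2)) (x (i + 2)) = -1
  · obtain ⟨i, h1, h2⟩ := h
    obtain ⟨s, hs, hp, hg⟩ := ProjTrig.exists_signs (e := fun i => Matrix.toBilin' N (x i) (x i))
      (g := fun i => Matrix.toBilin' N (x (i + 1)) (x (i + 2))) (D.prod_neg hre)
    exact ⟨s, hs, hp, hg, fun j h3 _ => absurd h3 (D.polar_exterior hre h1 h2 _)⟩
  · obtain ⟨s, hs, hp, hg⟩ := ProjTrig.exists_signs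
      (e := fun i => Matrix.toBilin' N (x' i) (x' i))
      (g := fun i => Matrix.toBilin' N (x' (i + 1)) (x' (i + 2))) (D.symm.prod_neg hre)
    exact ⟨s, hs, hp, fun i h1 h2 => absurd ⟨i, h1, h2⟩ h, hg⟩

/-- The sign of a magnitude. -/
theorem exists_sign_of_sq {C g s : ℝ} (hs : s = 1 ∨ s = -1) (h : C = g ∨ C = -g) :
    ∃ σ : ℝ, (σ = 1 ∨ σ = -1) ∧ σ * C = -(s * g) ∧ (C = -(s * g) → σ = 1) := by
  by_cases hC : C = -(s * g)
  · exact ⟨1, .inl rfl, by rw [one_mul, hC], fun _ => rfl⟩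
  · refine ⟨-1, .inr rfl, ?_, fun h => absurd h hC⟩
    rcases hs with rfl | rfl <;> rcases h with rfl | rfl
    · ring
    · exact absurd (by ring) hC
    · exact absurd (by ring) hC
    · ring

/-- The signs of the sides of one of the two triangles. -/
theorem RealTriple.exists_side_signs (D : RealTriple Φ N κ T T' x x' k) (hre : ¬ Φ.IsImaginary)
    {s : Fin 3 → ℝ} (hs : ∀ i, s i = 1 ∨ s i = -1)
    (hg : ∀ i, Matrix.toBilin' N (x (i + 1)) (x (i + 1)) = -1 →
      Matrix.toBilin' N (x (i + 2)) (x (i + 2)) = -1 →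
      s i * Matrix.toBilin' N (x (i + 1)) (x (i + 2)) ≤ 0)
    {t : Fin 3 → Translation} {η : ℝ} (hη : η = 1 ∨ η = -1)
    (hC : ∀ i, Matrix.toBilin' N (x' i) (x' i) = -1 →
      (t i).C = η * Matrix.toBilin' N (x (i + 1)) (x (i + 2)))
    (hC1 : ∀ i, Matrix.toBilin' N (x' i) (x' i) = 1 →
      (t i).C = |Matrix.toBilin' N (x (i + 1)) (x (i + 2))|) :
    ∃ σ : Fin 3 → ℝ, (∀ i, σ i = 1 ∨ σ i = -1) ∧
      (∀ i, σ i * (t i).C = -(s i * Matrix.toBilin' N (x (i + 1)) (x (i + 2)))) ∧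
      ∀ i, Φ.Interior (T (i + 1)) → Φ.Interior (T (i + 2)) → σ i = 1 := by
  have h : ∀ i, (t i).C = Matrix.toBilin' N (x (i + 1)) (x (i + 2)) ∨
      (t i).C = -Matrix.toBilin' N (x (i + 1)) (x (i + 2)) := by
    intro i
    rcases D.norm' i with h | h
    · rw [hC1 i h]
      exact abs_choice _
    · rw [hC i h]
      rcases hη with rfl | rfl
      · left; ring
      · right; ring
  choose σ hσ hσC hσ1 using fun i => exists_sign_of_sq (hs i) (h i)
  refine ⟨σ, hσ, hσC, fun i h1 h2 => hσ1 i ?_⟩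
  rw [D.interior_iff] at h1 h2
  rw [hC1 i ((D.norm' i).resolve_right (D.polar_exterior hre h1 h2 i))]
  have := hg i h1 h2
  rcases hs i with h | h
  · rw [h, one_mul] at this ⊢
    exact abs_of_nonpos this
  · rw [h] at this ⊢
    rw [abs_of_nonneg (by linarith)]
    ring

/-- The signed magnitudes are `-s_i g_i` and `-s_i g'_i`. Multiplying `RealTriple.law` by `-s_i` and
using `s_{i+1} s_{i+2} = s_i` gives both laws. -/
theorem RealTriple.hyperbolicLaws {x x' : Fin 3 → Fin 3 → ℝ}
    (D : RealTriple Φ N κ T (Φ.polarTriangle T) x x' k) (hre : ¬ Φ.IsImaginary)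
    {t t' : Fin 3 → Translation} {η η' : ℝ} (hη : η = 1 ∨ η = -1) (hη' : η' = 1 ∨ η' = -1)
    (hS : ∀ i, (t i).S = Real.sqrt |Matrix.toBilin' N (x (i + 1)) (x (i + 1)) *
      Matrix.toBilin' N (x (i + 2)) (x (i + 2)) - Matrix.toBilin' N (x (i + 1)) (x (i + 2)) ^ 2|)
    (hS' : ∀ i, (t' i).S = Real.sqrt |Matrix.toBilin' N (x' (i + 1)) (x' (i + 1)) *
      Matrix.toBilin' N (x' (i + 2)) (x' (i + 2)) - Matrix.toBilin' N (x' (i + 1)) (x' (i + 2)) ^ 2|)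
    (hC : ∀ i, Matrix.toBilin' N (x' i) (x' i) = -1 →
      (t i).C = η * Matrix.toBilin' N (x (i + 1)) (x (i + 2)))
    (hC1 : ∀ i, Matrix.toBilin' N (x' i) (x' i) = 1 →
      (t i).C = |Matrix.toBilin' N (x (i + 1)) (x (i + 2))|)
    (hC' : ∀ i, Matrix.toBilin' N (x i) (x i) = -1 →
      (t' i).C = η' * Matrix.toBilin' N (x' (i + 1)) (x' (i + 2)))
    (hC1' : ∀ i, Matrix.toBilin' N (x i) (x i) = 1 →
      (t' i).C = |Matrix.toBilin' N (x' (i + 1)) (x' (i + 2))|) :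
    Φ.HyperbolicLaws T t t' := by
  obtain ⟨s, hs, hp, hg, hg'⟩ := D.exists_signs hre
  obtain ⟨σ, hσ, hσC, hσ1⟩ := D.exists_side_signs hre hs hg hη hC hC1
  obtain ⟨σ', hσ', hσC', hσ1'⟩ := D.symm.exists_side_signs hre hs hg' hη' hC' hC1'
  refine ⟨σ, σ', fun i => ⟨hσ i, hσ' i⟩, hσ1, hσ1', fun i => ?_⟩
  have l1 := D.law hS i
  have l2 := D.symm.law hS' i
  have hp := hp i
  rw [D.sgn_eq, D.symm.sgn_eq, hσC, hσC, hσC, hσC', hσC', hσC']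
  obtain ⟨e11, e12, e21, e22, -⟩ := Fin.three_add i
  rw [e11, e12, e21, e22]
  constructor
  · linear_combination -(s i) * l1 + Matrix.toBilin' N (x (i + 2)) (x i) *
      Matrix.toBilin' N (x i) (x (i + 1)) * hp
  · linear_combination -(s i) * l2 + Matrix.toBilin' N (x' (i + 2)) (x' i) *
      Matrix.toBilin' N (x' i) (x' (i + 1)) * hp

end

end ProjTrig

end

/-- The projective law of cosines, its dual, and its elliptic and hyperbolic specialisations. -/
theorem mainTheorem1 :
    (∀ (Φ : ProjTrig.Conic) (T : Fin 3 → ProjTrig.Point) (o : Φ.Orientation T)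
        (o' : Φ.Orientation (Φ.polarTriangle T)),
        Φ.GeneralPosition T → ¬ Φ.RightAngled T → Φ.CoherentlyOriented T o o' →
        ∀ i : Fin 3,
          o.cc i = -(o.ss (i + 2) * o.ss (i + 1) * o'.cc i) - o.cc (i + 2) * o.cc (i + 1) ∧
          o'.cc i = -(o'.ss (i + 2) * o'.ss (i + 1) * o.cc i) - o'.cc (i + 2) * o'.cc (i + 1)) ∧
    (∀ (Φ : ProjTrig.Conic) (T : Fin 3 → ProjTrig.Point),
        Φ.HasRealEquation → (∀ i, ProjTrig.IsRealPoint (T i)) → Φ.GeneralPosition T →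
        ∃ t t' : Fin 3 → ProjTrig.Translation,
          Φ.TranslatesSides T t ∧ Φ.TranslatesSides (Φ.polarTriangle T) t' ∧
          (Φ.IsImaginary → ProjTrig.EllipticLaws t t') ∧
          (¬ Φ.IsImaginary → Φ.HyperbolicLaws T t t')) := by
  refine ⟨fun Φ T o o' hT _ h i => ProjTrig.law_of_cosines o o' hT h i, ?_⟩
  intro Φ T hreal hT hgen
  obtain ⟨N, κ, R⟩ := hreal.exists_realEquation
  obtain ⟨x, x', k, D⟩ := R.exists_realTriple hgen hT
  -- The choices `cos a = -g` for the triangle and `cos α = g'` for its polar triangle turn the Gram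
  -- identity, with all norms `-1`, into the elliptic laws. In the hyperbolic case any choice works,
  -- as the signs of the magnitudes absorb it.
  obtain ⟨t, ht, hS, hC, hC1⟩ := D.exists_translations (η := -1) (by norm_num)
  obtain ⟨t', ht', hS', hC', hC1'⟩ := D.symm.exists_translations (η := 1) (by norm_num)
  exact ⟨t, t', ht, ht', fun him => D.ellipticLaws him hS hS' hC hC',
    fun hre => D.hyperbolicLaws hre (.inr rfl) (.inl rfl) hS hS' hC hC1 hC' hC1'⟩
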